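/- **Background notions.** An *sc-Banach space* is a Banach space $E=E_0$ with Banach spaces $E_0\supset E_1\supset E_2\supset\cdots$ such that the inclusions $E_{m+1}\to E_m$ are compact and $E_\infty=\bigcap_m E_m$ is dense in every $E_m$; its tangent is $TE=E^1\oplus E$, with levels $(TE)_m=E_{m+1}\oplus E_m$, and $TU=\{(x,h)\in TE: x\in U\}$ for $U\subset E$ open. A map $f:U\to F$ on an open set $U\subset E$ is $\mathrm{sc}^0$ if for all $m$ it maps $U_m=U\cap E_m$ into $F_m$ continuously; it is $\mathrm{sc}^{k+1}$ if it is $\mathrm{sc}^0$, every $x\in U_1$ has a bounded operator $Df(x):E_0\to F_0$ with $\|f(x+h)-f(x)-Df(x)h\|_0/\|h\|_1\to 0$ as $\|h\|_1\to0$, and $Tf(x,h)=(f(x),Df(x)h)$ is an $\mathrm{sc}^k$ map $TU\to TF$; it is sc-smooth if it is $\mathrm{sc}^k$ for all $k$. An *sc-smooth retract* is the image $O=r(U)$ of an sc-smooth $r:U\to U$, $U\subset E$ open, with $r\circ r=r$; $TO=Tr(TU)$, and a map $f$ on $O$ is sc-smooth if $f\circ r$ is, with tangent map $Tf=T(f\circ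 r)|_{TO}$. An *M-polyfold* is a metrizable space $Z$ with an atlas of homeomorphisms from open sets of $Z$ onto sc-smooth retracts, with sc-smooth transition maps; $Z_m$ is the set of points that charts map into level $m$, and for $z\in Z_1$ the tangent space $T_zZ$ is formed, as for Banach manifolds, from charts and vectors in the tangents of their retracts. **The category.** Let $\mathcal C$ be a category in which every morphism is an isomorphism and there are only finitely many morphisms between any two objects, with a metrizable topology on its orbit space $|\mathcal C|$ of isomorphism classes. A *good uniformizer* around an object $c$ with automorphism group $G$ is a functor $\Psi:G\ltimes O\to\mathcal C$ on the translation groupoid of an sc-smooth action of $G$ on an M-polyfold $O$ such that (i) $\Psi$ is full and faithful; (ii) $\Psi(q_0)=c$ for some $q_0\in O$; (iii) the induced map $|\Psi|:G\backslash O\to|\mathcal C|$ is a homeomorphism onto an open neighborhood of $|c|$; (iv) every $q\in O$ has an open neighborhood $U(q)$ such that every sequence $(q_k)$ in $U(q)$ for which $|\Psi(q_k)|$ converges in $|\mathcal C|$ has a subsequence converging to a point of $\mathrm{cl}_O(U(q))$. A *polyfold structure* $(F,\mathbf M)$ on $\mathcal C$ consists of a non-empty set $F(c)$ of good uniformizers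 around each object $c$, and an M-polyfold structure on each transition set $\mathbf M(\Psi,\Psi')=\{(q,\Phi,q'): q\in O,\ q'\in O',\ \Phi:\Psi(q)\to\Psi'(q')\}$ (for $\Psi\in F(c)$, $\Psi'\in F(c')$), such that the source map $s(q,\Phi,q')=q$ and the target map $t(q,\Phi,q')=q'$ are local sc-diffeomorphisms and all structural maps (source, target, unit, inversion, multiplication) are sc-smooth. Let $(F,\mathbf M)$ be a polyfold structure on $\mathcal C$. An object $c$ has *regularity at least $r$* if $q\in O_r$ for some $\Psi\in F(c)$ and $q\in O$ with $\Psi(q)=c$. Let $\mathcal C^1$ be the full subcategory of the objects of regularity at least $1$. **Tuples.** Consider tuples $(c,\Psi,(q,h))$ with $c$ an object of $\mathcal C^1$, $\Psi\in F(c)$, $\Psi(q)=c$ and $h\in T_qO$. Given a morphism $\phi:c\to c'$ of $\mathcal C^1$, and $\Psi\in F(c)$, $\Psi'\in F(c')$ with $\Psi(q)=c$, $\Psi'(q')=c'$, put $L=t\circ(s|_{U(q,\phi,q')})^{-1}$, where $U(q,\phi,q')\subset\mathbf M(\Psi,\Psi')$ is an open neighborhood of $(q,\phi,q')$ on which $s$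 and $t$ are sc-diffeomorphisms onto open neighborhoods of $q$ and $q'$. Write $(c,\Psi,(q,h))\simeq(c',\Psi',(q',h'))$ if $c=c'$ and $TL(q,h)=(q',h')$ for the $L$ belonging to $\phi=1_c$. **Lemma.** There is a well-defined tangent category $T\mathcal C$ with a projection functor $\tau:T\mathcal C\to\mathcal C^1$. In detail: 1. Having regularity at least $r$ does not depend on the choice of $\Psi\in F(c)$ and of $q$ with $\Psi(q)=c$. The maps $L$ exist, and $TL(q,h)\in T_{q'}O'$ does not depend on the choice of $U(q,\phi,q')$. 2. $\simeq$ is an equivalence relation. Its classes $[(c,\Psi,(q,h))]$ are the objects of $T\mathcal C$, and $\tau([(c,\Psi,(q,h))])=c$. 3. For each morphism $\phi:c\to c'$ the map $T\phi:\tau^{-1}(c)\to\tau^{-1}(c')$, $T\phi([(c,\Psi,(q,h))])=[(c',\Psi',TL(q,h))]$, with $L$ belonging to $\phi$, is well-defined, and $T(1_c)=\mathrm{id}$, $T(\psi\circ\phi)=T\psi\circ T\phi$. For $c$ in $\mathcal C^1$ the fiber $\tau^{-1}(c)$ is a Banach space (up to equivalence of norms) such that for all $\Psi\in F(c)$ and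 $q$ with $\Psi(q)=c$ the map $h\mapsto[(c,\Psi,(q,h))]$ is, in every chart of $O$ around $q$, a topological linear isomorphism from the tangent space of the retract; and every $T\phi$ is a topological linear isomorphism. 4. The morphisms $x\to y$ of $T\mathcal C$ are the lifts $(x,T\phi,y)$ of the morphisms $\phi:\tau(x)\to\tau(y)$ of $\mathcal C^1$ with $T\phi(x)=y$ (the lift remembers $\phi$). They form a category, and $\tau(x,T\phi,y)=\phi$ makes $\tau$ a functor $T\mathcal C\to\mathcal C^1$. -/

import Mathlib

open CategoryTheory Topology Filter

universe e w u v

namespace Polyfold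

/-! ### Sc-Banach spaces -/

/-- An sc-Banach space `E = E₀ ⊇ E₁ ⊇ E₂ ⊇ ⋯`.  The level `E_m` is the Banach space `Lvl m`, and
the inclusion `E_{m+1} ⊆ E_m` is the injective continuous linear map `incl m`. -/
structure ScBanach where
  Lvl : ℕ → Type e
  [grp : ∀ m, NormedAddCommGroup (Lvl m)]
  [spc : ∀ m, NormedSpace ℝ (Lvl m)]
  [cpl : ∀ m, CompleteSpace (Lvl m)]
  incl : ∀ m, Lvl (m + 1) →L[ℝ] Lvl m
  incl_injective : ∀ m, Function.Injective (incl m)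
  incl_compact : ∀ m, IsCompactOperator (incl m)
  /-- `E_∞ = ⋂ E_n` is dense in every `E_m`; a point of `E_∞` is seen here as the sequence of its
  copies in the levels. -/
  dense_infty : ∀ m, Dense {x : Lvl m | ∃ s : ∀ n, Lvl n, (∀ n, incl n (s (n + 1)) = s n) ∧ s m = x}

attribute [instance] ScBanach.grp ScBanach.spc ScBanach.cpl

namespace ScBanach

/-- The inclusion `E_m ⊆ E₀`. -/
def toZero (E : ScBanach.{e}) : ∀ m, E.Lvl m →L[ℝ] E.Lvl 0
  | 0 => ContinuousLinearMap.id ℝ (E.Lvl 0)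
  | m + 1 => (toZero E m).comp (E.incl m)

theorem isCompactOperator_prodMap {A B A' B' : Type*}
    [NormedAddCommGroup A] [NormedSpace ℝ A] [NormedAddCommGroup B] [NormedSpace ℝ B]
    [NormedAddCommGroup A'] [NormedSpace ℝ A'] [NormedAddCommGroup B'] [NormedSpace ℝ B']
    {f : A →L[ℝ] A'} {g : B →L[ℝ] B'} (hf : IsCompactOperator f) (hg : IsCompactOperator g) :
    IsCompactOperator (f.prodMap g) := by
  obtain ⟨K, hK, hK'⟩ := hf
  obtain ⟨L, hL, hL'⟩ := hg
  exact ⟨K ×ˢ L, hK.prod hL, prod_mem_nhds hK' hL'⟩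

/-- The tangent `TE = E¹ ⊕ E`, with levels `(TE)_m = E_{m+1} ⊕ E_m`. -/
noncomputable def tangent (E : ScBanach.{e}) : ScBanach.{e} where
  Lvl m := E.Lvl (m + 1) × E.Lvl m
  incl m := (E.incl (m + 1)).prodMap (E.incl m)
  incl_injective m := (E.incl_injective (m + 1)).prodMap (E.incl_injective m)
  incl_compact m := isCompactOperator_prodMap (E.incl_compact (m + 1)) (E.incl_compact m)
  dense_infty m := by
    refine ((E.dense_infty (m + 1)).prod (E.dense_infty m)).mono ?_
    rintro ⟨x, h⟩ ⟨⟨a, ha, hax⟩, ⟨b, hb, hbh⟩⟩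
    exact ⟨fun n => (a (n + 1), b n), fun n => Prod.ext (ha (n + 1)) (hb n), Prod.ext hax hbh⟩

/-- `TU = U¹ ⊕ E`, the part of `TE` over a subset `U` of `E`. -/
def tangentSet (E : ScBanach.{e}) (U : Set (E.Lvl 0)) : Set (E.tangent.Lvl 0) :=
  {p | E.incl 0 p.1 ∈ U}

end ScBanach

/-! ### Sc-smooth maps -/

/-- `f` is of class sc⁰ on `U`: for every `m` it maps `U_m = U ∩ E_m` into `F_m`, continuously for
the topologies of the levels `m`. -/
def ScZero (E F : ScBanach.{e}) (U : Set (E.Lvl 0)) (f : E.Lvl 0 → F.Lvl 0) : Prop :=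
  ∀ m, ∃ g : E.Lvl m → F.Lvl m, ContinuousOn g (E.toZero m ⁻¹' U) ∧
    ∀ x ∈ E.toZero m ⁻¹' U, F.toZero m (g x) = f (E.toZero m x)

/-- `T'` is the tangent map `Tf (x, h) = (f x, Df(x) h)` of `f` on `TU`, where for `x ∈ U₁` the
operator `Df(x) : E₀ → F₀` is the sc-linearization of `f` at `x`. -/
def IsScTangent (E F : ScBanach.{e}) (U : Set (E.Lvl 0)) (f : E.Lvl 0 → F.Lvl 0)
    (T' : E.tangent.Lvl 0 → F.tangent.Lvl 0) : Prop :=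
  ∀ x : E.Lvl (0 + 1), E.incl 0 x ∈ U → ∃ D : E.Lvl 0 →L[ℝ] F.Lvl 0,
    ((fun h : E.Lvl (0 + 1) => f (E.incl 0 (x + h)) - f (E.incl 0 x) - D (E.incl 0 h))
      =o[𝓝 0] fun h => h) ∧
    ∀ h : E.Lvl 0, F.incl 0 (T' (x, h)).1 = f (E.incl 0 x) ∧ (T' (x, h)).2 = D h

/-- `f` is of class sc^k on the open set `U`. -/
def ScDiff : ℕ → (E F : ScBanach.{e}) → Set (E.Lvl 0) → (E.Lvl 0 → F.Lvl 0) → Prop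
  | 0, E, F, U, f => ScZero E F U f
  | k + 1, E, F, U, f => ScZero E F U f ∧ ∃ T' : E.tangent.Lvl 0 → F.tangent.Lvl 0,
      IsScTangent E F U f T' ∧ ScDiff k E.tangent F.tangent (E.tangentSet U) T'

/-- `f` is sc-smooth on the open set `U`. -/
def ScSmooth (E F : ScBanach.{e}) (U : Set (E.Lvl 0)) (f : E.Lvl 0 → F.Lvl 0) : Prop :=
  ∀ k, ScDiff k E F U f

/-! ### Sc-smooth retracts -/

/-- `r : U → U` is an sc-smooth retraction, defined on the open set `U ⊆ E`, with image `O`. -/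
structure IsScRetraction (E : ScBanach.{e}) (U : Set (E.Lvl 0)) (r : E.Lvl 0 → E.Lvl 0)
    (O : Set (E.Lvl 0)) : Prop where
  isOpen : IsOpen U
  mapsTo : Set.MapsTo r U U
  smooth : ScSmooth E E U r
  idem : ∀ x ∈ U, r (r x) = r x
  image : r '' U = O

/-- `(O, E)` is a local sc-model. -/
def IsScRetract (E : ScBanach.{e}) (O : Set (E.Lvl 0)) : Prop :=
  ∃ U r, IsScRetraction E U r O

/-- The tangent `TO = Tr(TU)` of an sc-smooth retract. -/
def retractTangent (E : ScBanach.{e}) (O : Set (E.Lvl 0)) : Set (E.tangent.Lvl 0) :=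
  {p | ∃ U r, IsScRetraction E U r O ∧
    ∃ T' : E.tangent.Lvl 0 → E.tangent.Lvl 0, IsScTangent E E U r T' ∧ p ∈ T' '' E.tangentSet U}

/-- The map `f` on the retract `O ⊆ E` is sc-smooth: `f ∘ r` is sc-smooth for a retraction `r`
with image `O`. -/
def ScSmoothOnRetract (E F : ScBanach.{e}) (O : Set (E.Lvl 0)) (f : E.Lvl 0 → F.Lvl 0) : Prop :=
  ∃ U r, IsScRetraction E U r O ∧ ScSmooth E F U (f ∘ r)

/-- `Tf p = p'`, where `Tf = T(f ∘ r)` restricted to `TO` is the tangent map of a map `f` on the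
retract `O`. -/
def RetractTangentMap (E F : ScBanach.{e}) (O : Set (E.Lvl 0)) (f : E.Lvl 0 → F.Lvl 0)
    (p : E.tangent.Lvl 0) (p' : F.tangent.Lvl 0) : Prop :=
  p ∈ retractTangent E O ∧ ∃ U r, IsScRetraction E U r O ∧
    ∃ T' : E.tangent.Lvl 0 → F.tangent.Lvl 0, IsScTangent E F U (f ∘ r) T' ∧ T' p = p'

/-! ### M-polyfolds -/

/-- A chart `(φ, U, (O, E))` of `Z`: a homeomorphism `φ` from the open set `U = φ.source` of `Z`
onto the sc-smooth retract `O = φ.target` in `E`. -/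
structure Chart (Z : Type w) [TopologicalSpace Z] where
  E : ScBanach.{e}
  φ : PartialEquiv Z (E.Lvl 0)
  isOpen_source : IsOpen φ.source
  isScRetract_target : IsScRetract E φ.target
  continuousOn : ContinuousOn φ φ.source
  continuousOn_symm : ContinuousOn φ.symm φ.target

/-- The transition map `φ' ∘ φ⁻¹ : φ(U ∩ U') → φ'(U ∩ U')` is sc-smooth. -/
def Chart.SmoothTransition {Z : Type w} [TopologicalSpace Z] (κ κ' : Chart.{e} Z) : Prop :=
  ScSmoothOnRetract κ.E κ'.E (κ.φ '' (κ.φ.source ∩ κ'.φ.source)) (κ'.φ ∘ κ.φ.symm)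

/-- An M-polyfold structure on the topological space `Z`: `Z` is metrizable, and the sc-smooth
structure is given by an sc-smooth atlas. -/
structure MPolyfold (Z : Type w) [TopologicalSpace Z] where
  metrizable : TopologicalSpace.MetrizableSpace Z
  atlas : Set (Chart.{e} Z)
  cover : ∀ z, ∃ κ ∈ atlas, z ∈ κ.φ.source
  compat : ∀ κ ∈ atlas, ∀ κ' ∈ atlas, κ.SmoothTransition κ'

namespace MPolyfold

variable {Z : Type*} [TopologicalSpace Z] (X : MPolyfold.{e} Z)
variable {Z' : Type*} [TopologicalSpace Z'] (Y : MPolyfold.{e} Z')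

/-- The set `Z_m` of points of regularity at least `m`. -/
def level (m : ℕ) : Set Z :=
  {z | ∃ κ ∈ X.atlas, z ∈ κ.φ.source ∧ κ.φ z ∈ Set.range (κ.E.toZero m)}

/-- `f` is sc-smooth on the open set `S ⊆ Z`: it is continuous there, and sc-smooth in all
charts. -/
def ScSmoothOn (S : Set Z) (f : Z → Z') : Prop :=
  ContinuousOn f S ∧ ∀ κ ∈ X.atlas, ∀ κ' ∈ Y.atlas,
    ScSmoothOnRetract κ.E κ'.E (κ.φ '' (κ.φ.source ∩ S ∩ f ⁻¹' κ'.φ.source))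
      (κ'.φ ∘ f ∘ κ.φ.symm)

/-- The homeomorphism `σ` between open sets is an sc-diffeomorphism. -/
def IsScDiffeo (σ : OpenPartialHomeomorph Z Z') : Prop :=
  X.ScSmoothOn Y σ.source σ ∧ Y.ScSmoothOn X σ.target σ.symm

/-- `f` is a local sc-diffeomorphism. -/
def IsLocalScDiffeo (f : Z → Z') : Prop :=
  ∀ z, ∃ σ : OpenPartialHomeomorph Z Z', z ∈ σ.source ∧ Set.EqOn f σ σ.source ∧ X.IsScDiffeo Y σ

/-- Let `p : P → Z` be a local homeomorphism.  The map `f : P → Z'` is sc-smooth for the M-polyfold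
structure on `P` for which `p` is a local sc-diffeomorphism. -/
def ScSmoothVia {P : Type*} [TopologicalSpace P] (p : P → Z) (f : P → Z') : Prop :=
  Continuous f ∧ ∀ σ : OpenPartialHomeomorph P Z, Set.EqOn p σ σ.source →
    X.ScSmoothOn Y σ.target (f ∘ σ.symm)

/-- A representative `(z, φ, U, (O, E), h)` of a tangent vector at `z`: a chart around `z`, and
`vec = (φ z, h) ∈ TO` over `φ z`.  In particular `φ z ∈ E₁`, that is, `z ∈ Z₁`. -/
structure TangentRep (z : Z) where
  κ : Chart.{e} Z
  mem_atlas : κ ∈ X.atlas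
  mem_source : z ∈ κ.φ.source
  vec : κ.E.tangent.Lvl 0
  vec_mem : vec ∈ retractTangent κ.E κ.φ.target
  vec_base : κ.E.incl 0 vec.1 = κ.φ z

/-- Two representatives are equivalent if `T(φ' ∘ φ⁻¹)` maps the first to the second. -/
def TangentRep.Rel {X : MPolyfold.{e} Z} {z : Z} (a b : X.TangentRep z) : Prop :=
  RetractTangentMap a.κ.E b.κ.E (a.κ.φ '' (a.κ.φ.source ∩ b.κ.φ.source)) (b.κ.φ ∘ a.κ.φ.symm)
    a.vec b.vec

/-- The tangent space `T_z Z`; it is empty unless `z ∈ Z₁`. -/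
def TangentSpace (z : Z) := Quot (TangentRep.Rel (X := X) (z := z))

/-- `Tf (z, h) = (z', h')`, where `f` is an sc-smooth map on the open set `S`. -/
def TangentMap (S : Set Z) (f : Z → Z') {z : Z} {z' : Z'} (h : X.TangentSpace z)
    (h' : Y.TangentSpace z') : Prop :=
  z ∈ S ∧ f z = z' ∧ ∃ (a : X.TangentRep z) (b : Y.TangentRep z'),
    h = Quot.mk _ a ∧ h' = Quot.mk _ b ∧
    RetractTangentMap a.κ.E b.κ.E (a.κ.φ '' (a.κ.φ.source ∩ S ∩ f ⁻¹' b.κ.φ.source))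
      (b.κ.φ ∘ f ∘ a.κ.φ.symm) a.vec b.vec

theorem mem_level_of_tangent {z : Z} (h : X.TangentSpace z) : z ∈ X.level 1 := by
  obtain ⟨a, -⟩ := Quot.exists_rep h
  exact ⟨a.κ, a.mem_atlas, a.mem_source, a.vec.1, a.vec_base⟩

end MPolyfold

/-! ### Good uniformizers and polyfold structures -/

/-- The orbit space `|C|`: the isomorphism classes of objects of `C`. -/
def OrbitSpace (C : Type u) [Category.{v} C] := Quotient (isIsomorphicSetoid C)

/-- The class `|c|` of an object `c`. -/
def orbit {C : Type u} [Category.{v} C] (c : C) : OrbitSpace C :=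
  Quotient.mk (isIsomorphicSetoid C) c

/-- A good category with metrizable orbit space. -/
class GCT (C : Type u) [Category.{v} C] where
  finite_hom : ∀ c d : C, Finite (c ⟶ d)
  isIso : ∀ {c d : C} (φ : c ⟶ d), IsIso φ
  top : TopologicalSpace (OrbitSpace C)
  metrizable : TopologicalSpace.MetrizableSpace (OrbitSpace C)

attribute [instance] GCT.finite_hom GCT.isIso GCT.metrizable
attribute [reducible, instance] GCT.top

/-- The map `|Ψ| : G\O → |C|` induced on orbit spaces by a functor `Ψ : G ⋉ O → C` on a translation
groupoid. -/
def orbitMap {C : Type u} [Category.{v} C] {G O : Type*} [Group G] [MulAction G O]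
    (Ψ : ActionCategory G O ⥤ C) : Quotient (MulAction.orbitRel G O) → OrbitSpace C :=
  Quotient.lift (fun q : O => orbit (Ψ.obj q)) (by
    rintro a b ⟨g, hg⟩
    have f : @Quiver.Hom (ActionCategory G O) _ b a := ⟨g, hg⟩
    exact (Quotient.sound (s := isIsomorphicSetoid C) ⟨Ψ.mapIso (Groupoid.isoEquivHom (C := ActionCategory G O) b a |>.symm f)⟩).symm)

/-- A good uniformizer `Ψ : G ⋉ O → C` around the object `c` with automorphism group `G`. -/
structure GoodUniformizer {C : Type u} [Category.{v} C] [GCT C] (c : C) where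
  O : Type w
  [top : TopologicalSpace O]
  mpoly : MPolyfold.{e} O
  [act : MulAction (Aut c) O]
  smooth_act : ∀ g : Aut c, mpoly.ScSmoothOn mpoly Set.univ (fun q => g • q)
  Ψ : ActionCategory (Aut c) O ⥤ C
  full : Ψ.Full
  faithful : Ψ.Faithful
  exists_base : ∃ q₀ : O, Ψ.obj q₀ = c
  /-- `|Ψ|` is a homeomorphism onto an open subset of `|C|`, which contains `|c|` by the previous
  property. -/
  isOpenEmbedding : IsOpenEmbedding (orbitMap Ψ)
  proper : ∀ q : O, ∃ U : Set O, IsOpen U ∧ q ∈ U ∧ ∀ s : ℕ → O, (∀ k, s k ∈ U) →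
    (∃ l, Tendsto (fun k => orbit (Ψ.obj (s k : O))) atTop (𝓝 l)) →
    ∃ l ∈ closure U, ∃ n : ℕ → ℕ, StrictMono n ∧ Tendsto (s ∘ n) atTop (𝓝 l)

attribute [instance] GoodUniformizer.top GoodUniformizer.act

section

variable {C : Type u} [Category.{v} C] [GCT C]

/-- The object `Ψ(q)`. -/
def GoodUniformizer.obj {c : C} (Ψ : GoodUniformizer.{e, w} c) (q : Ψ.O) : C := Ψ.Ψ.obj q

/-- The transition set `M(Ψ, Ψ')` of all `(q, Φ, q')` with `Φ : Ψ(q) → Ψ'(q')`. -/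
@[ext]
structure Transition {c c' : C} (Ψ : GoodUniformizer.{e, w} c) (Ψ' : GoodUniformizer.{e, w} c') where
  src : Ψ.O
  tgt : Ψ'.O
  hom : Ψ.obj src ⟶ Ψ'.obj tgt

namespace Transition

variable {c c' c'' : C} {Ψ : GoodUniformizer.{e, w} c} {Ψ' : GoodUniformizer.{e, w} c'}
  {Ψ'' : GoodUniformizer.{e, w} c''}

/-- The inversion map `(q, Φ, q') ↦ (q', Φ⁻¹, q)`. -/
noncomputable def inversion (x : Transition Ψ Ψ') : Transition Ψ' Ψ := ⟨x.tgt, x.src, inv x.hom⟩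

/-- The unit map `q ↦ (q, 1, q)`. -/
def unit (Ψ : GoodUniformizer.{e, w} c) (q : Ψ.O) : Transition Ψ Ψ := ⟨q, q, 𝟙 _⟩

/-- The fibered product `M(Ψ', Ψ'') ₛ×ₜ M(Ψ, Ψ')`. -/
def FiberProd (Ψ : GoodUniformizer.{e, w} c) (Ψ' : GoodUniformizer.{e, w} c')
    (Ψ'' : GoodUniformizer.{e, w} c'') :=
  {p : Transition Ψ' Ψ'' × Transition Ψ Ψ' // p.1.src = p.2.tgt}

/-- The multiplication map `((q', Φ', q''), (q, Φ, q')) ↦ (q, Φ' ∘ Φ, q'')`. -/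
def mul (p : FiberProd Ψ Ψ' Ψ'') : Transition Ψ Ψ'' :=
  ⟨p.1.2.src, p.1.1.tgt, p.1.2.hom ≫ eqToHom (congrArg Ψ'.obj p.2.symm) ≫ p.1.1.hom⟩

instance [TopologicalSpace (Transition Ψ' Ψ'')] [TopologicalSpace (Transition Ψ Ψ')] :
    TopologicalSpace (FiberProd Ψ Ψ' Ψ'') :=
  inferInstanceAs (TopologicalSpace {p : Transition Ψ' Ψ'' × Transition Ψ Ψ' // p.1.src = p.2.tgt})

end Transition

variable (C)

/-- A polyfold structure `(F, M)` on `C`: sets `F(c)` of good uniformizers around the objects `c`,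
and M-polyfold structures on the transition sets, such that the structural maps are sc-smooth, and
source and target are local sc-diffeomorphisms. -/
structure PolyfoldStructure where
  F : ∀ c : C, Set (GoodUniformizer.{e, w} c)
  nonempty : ∀ c, (F c).Nonempty
  top : ∀ {c c' : C} (Ψ : F c) (Ψ' : F c'), TopologicalSpace (Transition Ψ.1 Ψ'.1)
  M : ∀ {c c' : C} (Ψ : F c) (Ψ' : F c'), MPolyfold.{e} (Transition Ψ.1 Ψ'.1)
  src_local : ∀ {c c' : C} (Ψ : F c) (Ψ' : F c'),
    (M Ψ Ψ').IsLocalScDiffeo Ψ.1.mpoly Transition.src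
  tgt_local : ∀ {c c' : C} (Ψ : F c) (Ψ' : F c'),
    (M Ψ Ψ').IsLocalScDiffeo Ψ'.1.mpoly Transition.tgt
  src_smooth : ∀ {c c' : C} (Ψ : F c) (Ψ' : F c'),
    (M Ψ Ψ').ScSmoothOn Ψ.1.mpoly Set.univ Transition.src
  tgt_smooth : ∀ {c c' : C} (Ψ : F c) (Ψ' : F c'),
    (M Ψ Ψ').ScSmoothOn Ψ'.1.mpoly Set.univ Transition.tgt
  inversion_smooth : ∀ {c c' : C} (Ψ : F c) (Ψ' : F c'),
    (M Ψ Ψ').ScSmoothOn (M Ψ' Ψ) Set.univ Transition.inversion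
  unit_smooth : ∀ {c : C} (Ψ : F c),
    Ψ.1.mpoly.ScSmoothOn (M Ψ Ψ) Set.univ (Transition.unit Ψ.1)
  /-- The multiplication is sc-smooth on the fibered product.  Since the target map is a local
  sc-diffeomorphism, the first projection of the fibered product is a local homeomorphism, and the
  M-polyfold structure of the fibered product is the one that makes it a local
  sc-diffeomorphism. -/
  mul_smooth : ∀ {c c' c'' : C} (Ψ : F c) (Ψ' : F c') (Ψ'' : F c''),
    (M Ψ' Ψ'').ScSmoothVia (M Ψ Ψ'')
      (fun p : Transition.FiberProd Ψ.1 Ψ'.1 Ψ''.1 => p.1.1) Transition.mul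

variable {C}

namespace PolyfoldStructure

instance (S : PolyfoldStructure.{e, w} C) {c c' : C} (Ψ : S.F c) (Ψ' : S.F c') :
    TopologicalSpace (Transition Ψ.1 Ψ'.1) := S.top Ψ Ψ'

variable (S : PolyfoldStructure.{e, w} C)

/-! ### The tangent category -/

/-- The object `c` has regularity at least `r`. -/
def regularityGE (r : ℕ) : ObjectProperty C :=
  fun c => ∃ Ψ ∈ S.F c, ∃ q : Ψ.O, Ψ.obj q = c ∧ q ∈ Ψ.mpoly.level r

/-- The category `C¹`: the full subcategory of the objects of regularity at least `1`. -/
abbrev C₁ := (S.regularityGE 1).FullSubcategory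

/-- A tuple `(c, Ψ, (q, h))` with `Ψ ∈ F(c)`, `Ψ(q) = c` and `h ∈ T_q O`. -/
structure Tuple (c : C) where
  Ψ : S.F c
  q : Ψ.1.O
  obj_eq : Ψ.1.obj q = c
  h : Ψ.1.mpoly.TangentSpace q

variable {S}

/-- For `φ : c → c'` the relation `TL (q, h) = (q', h')` between tuples `(c, Ψ, (q, h))` and
`(c', Ψ', (q', h'))`, where `L = t ∘ (s|U(q, φ, q'))⁻¹` for an open neighborhood `U(q, φ, q')` of
`(q, φ, q')` in `M(Ψ, Ψ')` on which `s` and `t` are sc-diffeomorphisms onto open neighborhoods of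
`q` and `q'`. -/
def Lift {c c' : C} (φ : c ⟶ c') (a : S.Tuple c) (b : S.Tuple c') : Prop :=
  ∃ (σ : OpenPartialHomeomorph (Transition a.Ψ.1 b.Ψ.1) a.Ψ.1.O)
    (θ : OpenPartialHomeomorph (Transition a.Ψ.1 b.Ψ.1) b.Ψ.1.O),
    (⟨a.q, b.q, eqToHom a.obj_eq ≫ φ ≫ eqToHom b.obj_eq.symm⟩ : Transition a.Ψ.1 b.Ψ.1) ∈ σ.source ∧
    θ.source = σ.source ∧
    Set.EqOn Transition.src σ σ.source ∧ Set.EqOn Transition.tgt θ θ.source ∧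
    (S.M a.Ψ b.Ψ).IsScDiffeo a.Ψ.1.mpoly σ ∧ (S.M a.Ψ b.Ψ).IsScDiffeo b.Ψ.1.mpoly θ ∧
    a.Ψ.1.mpoly.TangentMap b.Ψ.1.mpoly σ.target (θ ∘ σ.symm) a.h b.h

variable (S)

/-- `(c, Ψ, (q, h)) ≃ (c', Ψ', (q', h'))`: one has `c = c'` and `TL (q, h) = (q', h')` for the map
`L` defined by the identity morphism. -/
def TupleRel (a b : Σ c : C, S.Tuple c) : Prop := ∃ hc : a.1 = b.1, Lift (eqToHom hc) a.2 b.2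

/-- The objects of the tangent category `TC`: the classes `[(c, Ψ, (q, h))]`. -/
def TObj := Quot S.TupleRel

variable {S}

theorem Tuple.regular {c : C} (a : S.Tuple c) : S.regularityGE 1 c :=
  ⟨a.Ψ.1, a.Ψ.2, a.q, a.obj_eq, MPolyfold.mem_level_of_tangent _ a.h⟩

/-- The projection `τ [(c, Ψ, (q, h))] = c` on objects. -/
def TObj.base : S.TObj → S.C₁ :=
  Quot.lift (fun a => ⟨a.1, a.2.regular⟩) (by
    rintro ⟨c, a⟩ ⟨c', b⟩ ⟨hc, -⟩
    cases hc
    rfl)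

variable (S)

/-- The fiber `τ⁻¹(c)`. -/
def Fiber (c : C) := {x : S.TObj // x.base.obj = c}

variable {S}

/-- The class `[(c, Ψ, (q, h))]` as an element of `τ⁻¹(c)`. -/
def Tuple.toFiber {c : C} (a : S.Tuple c) : S.Fiber c := ⟨Quot.mk _ ⟨c, a⟩, rfl⟩

end PolyfoldStructure

end

end Polyfold

/-!
The only analysis needed is sc-calculus of order one, at the level of germs.

The chain rule `HasScDeriv.comp` holds although the linearizations `Dg(w)` of an sc¹ map are only
strongly continuous in `w`: the inclusion `E₁ → E₀` is compact, so `Df(x)` maps the unit ball of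
`E₁` into a compact set, on which strong convergence is uniform. The linearization is unique
because `E₁` is dense in `E₀`. It follows that, for *every* retraction `r` with image `O`, the
tangent of `O` is the fixed point set of `Tr` (`IsScRetraction.mem_tangent_iff`), and that the
tangent map of a map between M-polyfolds can be computed from the linearization of any
coordinate representative `φ' ∘ f ∘ φ⁻¹ ∘ r` (`Chart.retractTangentMap_iff`). Hence equality of
tangent vectors and the relation `Tf (z, h) = (z', h')` become statements about germs
(`MPolyfold.TangentGerm`), for which existence, uniqueness and functoriality are formal.

For the polyfold structure it remains to understand the germs of the maps `L = t ∘ (s|U)⁻¹`. Such a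
germ is determined by the point `(q, φ, q')`, since `(s|U)⁻¹` is the germ of the continuous section
of the source map through that point. For `φ = 1` and `q = q'` that section is the unit map, so
`L` is the identity. As the multiplication is continuous, products of sections are sections,
so the map `L` of a composition is the composition of the maps `L`
(`TransitionNhd.map_eventuallyEq_comp`). As all morphisms are invertible, these two facts make `≃` an
equivalence relation and `T` a well-defined functor on the fibers.

In a chart the tangent space is the closed subspace of fixed vectors of the operator `Dr(x)`. It
parametrizes the fiber `τ⁻¹(c)` bijectively, and for two such parametrizations `Tφ` is the
restriction of the bounded operator `DL(x)`, with inverse coming from `φ⁻¹`. Thus the norm of any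
one parametrization makes all parametrizations, and all `Tφ`, topological linear isomorphisms.
-/

namespace Polyfold

/-! ### The sc-linearization at a point and the chain rule -/

section Calculus

variable {E F G : ScBanach.{e}}

theorem ScBanach.denseRange_incl (E : ScBanach.{e}) : DenseRange (E.incl 0) := by
  refine (E.dense_infty 0).mono ?_
  rintro x ⟨s, hs, rfl⟩
  exact ⟨s 1, hs 0⟩

/-- `D` is the sc-linearization of `f` at the point `x` of level one, and the value `f x` is the
point `y` of level one. -/
structure HasScDeriv (f : E.Lvl 0 → F.Lvl 0) (x : E.Lvl (0 + 1)) (y : F.Lvl (0 + 1))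
    (D : E.Lvl 0 →L[ℝ] F.Lvl 0) : Prop where
  isLittleO : (fun h : E.Lvl (0 + 1) => f (E.incl 0 (x + h)) - f (E.incl 0 x) - D (E.incl 0 h))
    =o[𝓝 0] fun h => h
  incl_eq : F.incl 0 y = f (E.incl 0 x)

/-- `f` is of class sc¹ on some open neighborhood of the point `x` of level zero. -/
def ScOneAt (E F : ScBanach.{e}) (f : E.Lvl 0 → F.Lvl 0) (x : E.Lvl 0) : Prop :=
  ∃ U, IsOpen U ∧ x ∈ U ∧ ScDiff 1 E F U f

theorem HasScDeriv.hasFDerivAt {f : E.Lvl 0 → F.Lvl 0} {x : E.Lvl (0 + 1)} {y : F.Lvl (0 + 1)}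
    {D : E.Lvl 0 →L[ℝ] F.Lvl 0} (h : HasScDeriv f x y D) :
    HasFDerivAt (fun w => f (E.incl 0 w)) (D.comp (E.incl 0)) x := by
  rw [hasFDerivAt_iff_isLittleO_nhds_zero]
  exact h.isLittleO

/-- The sc-linearization is unique because `E₁` is dense in `E₀`. -/
theorem HasScDeriv.unique {f : E.Lvl 0 → F.Lvl 0} {x : E.Lvl (0 + 1)} {y y' : F.Lvl (0 + 1)}
    {D D' : E.Lvl 0 →L[ℝ] F.Lvl 0} (h : HasScDeriv f x y D) (h' : HasScDeriv f x y' D') :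
    y = y' ∧ D = D' := by
  refine ⟨F.incl_injective 0 (h.incl_eq.trans h'.incl_eq.symm), ?_⟩
  have := h.hasFDerivAt.unique h'.hasFDerivAt
  refine ContinuousLinearMap.ext fun v => ?_
  refine congrFun (E.denseRange_incl.equalizer D.continuous D'.continuous ?_) v
  funext w
  exact congrArg (fun A : E.Lvl (0 + 1) →L[ℝ] F.Lvl 0 => A w) this

theorem HasScDeriv.congr {f g : E.Lvl 0 → F.Lvl 0} {x : E.Lvl (0 + 1)} {y : F.Lvl (0 + 1)}
    {D : E.Lvl 0 →L[ℝ] F.Lvl 0} (h : HasScDeriv f x y D) (hfg : f =ᶠ[𝓝 (E.incl 0 x)] g) :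
    HasScDeriv g x y D := by
  have hx := hfg.eq_of_nhds
  refine ⟨h.isLittleO.congr' ?_ EventuallyEq.rfl, h.incl_eq.trans hx⟩
  have ht : Tendsto (fun k : E.Lvl (0 + 1) => E.incl 0 (x + k)) (𝓝 0) (𝓝 (E.incl 0 x)) := by
    have : Continuous fun k : E.Lvl (0 + 1) => E.incl 0 (x + k) := by fun_prop
    simpa using this.tendsto 0
  filter_upwards [ht.eventually hfg] with k hk
  rw [hk, hx]

theorem ScZero.mono {U V : Set (E.Lvl 0)} {f : E.Lvl 0 → F.Lvl 0} (h : ScZero E F U f)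
    (hV : V ⊆ U) : ScZero E F V f := fun m =>
  let ⟨g, hg, hg'⟩ := h m
  ⟨g, hg.mono (Set.preimage_mono hV), fun x hx => hg' x (hV hx)⟩

theorem ScZero.congr {U : Set (E.Lvl 0)} {f g : E.Lvl 0 → F.Lvl 0} (h : ScZero E F U f)
    (hfg : Set.EqOn f g U) : ScZero E F U g := fun m =>
  let ⟨k, hk, hk'⟩ := h m
  ⟨k, hk, fun x hx => (hk' x hx).trans (hfg hx)⟩

theorem ScZero.comp {U : Set (E.Lvl 0)} {V : Set (F.Lvl 0)} {f : E.Lvl 0 → F.Lvl 0}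
    {g : F.Lvl 0 → G.Lvl 0} (hg : ScZero F G V g) (hf : ScZero E F U f) (h : Set.MapsTo f U V) :
    ScZero E G U (g ∘ f) := fun m => by
  obtain ⟨a, ha, ha'⟩ := hf m
  obtain ⟨b, hb, hb'⟩ := hg m
  have hab : Set.MapsTo a (E.toZero m ⁻¹' U) (F.toZero m ⁻¹' V) := fun x hx => by
    rw [Set.mem_preimage, ha' x hx]
    exact h hx
  refine ⟨b ∘ a, hb.comp ha hab, fun x hx => ?_⟩
  rw [Function.comp_apply, hb' _ (hab hx), ha' x hx, Function.comp_apply]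

theorem ScZero.continuousOn {U : Set (E.Lvl 0)} {f : E.Lvl 0 → F.Lvl 0} (h : ScZero E F U f) :
    ContinuousOn f U := by
  obtain ⟨g, hg, hg'⟩ := h 0
  exact hg.congr fun x hx => (hg' x hx).symm

theorem ScZero.mem_range {U : Set (E.Lvl 0)} {f : E.Lvl 0 → F.Lvl 0} (h : ScZero E F U f) {m : ℕ}
    {x : E.Lvl 0} (hx : x ∈ U) (hm : x ∈ Set.range (E.toZero m)) :
    f x ∈ Set.range (F.toZero m) := by
  obtain ⟨y, rfl⟩ := hm
  obtain ⟨g, -, hg⟩ := h m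
  exact ⟨g y, hg y hx⟩

theorem IsScTangent.mono {U V : Set (E.Lvl 0)} {f : E.Lvl 0 → F.Lvl 0}
    {T' : E.tangent.Lvl 0 → F.tangent.Lvl 0} (h : IsScTangent E F U f T') (hV : V ⊆ U) :
    IsScTangent E F V f T' := fun x hx => h x (hV hx)

theorem ScDiff.mono {k : ℕ} : ∀ {E F : ScBanach.{e}} {U V : Set (E.Lvl 0)}
    {f : E.Lvl 0 → F.Lvl 0}, ScDiff k E F U f → V ⊆ U → ScDiff k E F V f := by
  induction k with
  | zero => exact fun h hV => ScZero.mono h hV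
  | succ k ih =>
    rintro E F U V f ⟨h, T', hT, hk⟩ hV
    exact ⟨h.mono hV, T', hT.mono hV, ih hk fun p hp => hV hp⟩

theorem ScSmooth.mono {U V : Set (E.Lvl 0)} {f : E.Lvl 0 → F.Lvl 0} (h : ScSmooth E F U f)
    (hV : V ⊆ U) : ScSmooth E F V f := fun k => (h k).mono hV

theorem IsScTangent.hasScDeriv {U : Set (E.Lvl 0)} {f : E.Lvl 0 → F.Lvl 0}
    {T' : E.tangent.Lvl 0 → F.tangent.Lvl 0} (h : IsScTangent E F U f T') {x : E.Lvl (0 + 1)}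
    (hx : E.incl 0 x ∈ U) : ∃ y D, HasScDeriv f x y D ∧ ∀ v, T' (x, v) = (y, D v) := by
  obtain ⟨D, hD, hT⟩ := h x hx
  refine ⟨(T' (x, 0)).1, D, ⟨hD, (hT 0).1⟩, fun v => Prod.ext ?_ (hT v).2⟩
  exact F.incl_injective 0 ((hT v).1.trans (hT 0).1.symm)

theorem isScTangent_iff {U : Set (E.Lvl 0)} {f : E.Lvl 0 → F.Lvl 0}
    {T' : E.tangent.Lvl 0 → F.tangent.Lvl 0} : IsScTangent E F U f T' ↔
      ∀ x, E.incl 0 x ∈ U → ∃ y D, HasScDeriv f x y D ∧ ∀ v, T' (x, v) = (y, D v) := by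
  refine ⟨fun h x hx => h.hasScDeriv hx, fun h x hx => ?_⟩
  obtain ⟨y, D, hD, hT⟩ := h x hx
  exact ⟨D, hD.isLittleO, fun v => by rw [hT v]; exact ⟨hD.incl_eq, rfl⟩⟩

/-- A map which has sc-linearizations at all points of `U₁` has a tangent map over `U`. -/
theorem exists_isScTangent {U : Set (E.Lvl 0)} {f : E.Lvl 0 → F.Lvl 0}
    (h : ∀ x, E.incl 0 x ∈ U → ∃ y D, HasScDeriv f x y D) : ∃ T', IsScTangent E F U f T' := by
  choose! y D hD using h
  exact ⟨fun p => (y p.1, D p.1 p.2),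
    isScTangent_iff.2 fun x hx => ⟨y x, D x, hD x hx, fun v => rfl⟩⟩

theorem IsScTangent.congr {U : Set (E.Lvl 0)} (hU : IsOpen U) {f g : E.Lvl 0 → F.Lvl 0}
    {T' : E.tangent.Lvl 0 → F.tangent.Lvl 0} (h : IsScTangent E F U f T')
    (hfg : Set.EqOn f g U) : IsScTangent E F U g T' := by
  rw [isScTangent_iff] at h ⊢
  intro x hx
  obtain ⟨y, D, hD, hT⟩ := h x hx
  exact ⟨y, D, hD.congr (hfg.eventuallyEq_of_mem (hU.mem_nhds hx)), hT⟩

theorem ScOneAt.congr {f g : E.Lvl 0 → F.Lvl 0} {x : E.Lvl 0} (h : ScOneAt E F f x)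
    (hfg : f =ᶠ[𝓝 x] g) : ScOneAt E F g x := by
  obtain ⟨U, hU, hx, h⟩ := h
  obtain ⟨V, hV, hVo, hxV⟩ := eventually_nhds_iff.1 hfg
  obtain ⟨h0, T', hT, h1⟩ := h.mono (Set.inter_subset_left : U ∩ V ⊆ U)
  have heq : Set.EqOn f g (U ∩ V) := fun z hz => hV z hz.2
  exact ⟨U ∩ V, hU.inter hVo, ⟨hx, hxV⟩, h0.congr heq, T', hT.congr (hU.inter hVo) heq, h1⟩

theorem ScOneAt.hasScDeriv {f : E.Lvl 0 → F.Lvl 0} {x : E.Lvl (0 + 1)}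
    (h : ScOneAt E F f (E.incl 0 x)) : ∃ y D, HasScDeriv f x y D := by
  obtain ⟨U, hU, hx, -, T', hT, -⟩ := h
  obtain ⟨y, D, hD, -⟩ := hT.hasScDeriv hx
  exact ⟨y, D, hD⟩

/-- An sc¹ map lifts, near a point of level one, to a map of levels one which is continuous at that
point. -/
theorem ScOneAt.exists_lift {f : E.Lvl 0 → F.Lvl 0} {x : E.Lvl (0 + 1)}
    (h : ScOneAt E F f (E.incl 0 x)) : ∃ f₁ : E.Lvl (0 + 1) → F.Lvl (0 + 1),
      ContinuousAt f₁ x ∧ ∀ᶠ w in 𝓝 x, F.incl 0 (f₁ w) = f (E.incl 0 w) := by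
  obtain ⟨U, hU, hx, h, -⟩ := h
  obtain ⟨g, hg, hg'⟩ := h 1
  have hmem : E.incl 0 ⁻¹' U ∈ 𝓝 x := (hU.preimage (E.incl 0).continuous).mem_nhds hx
  exact ⟨g, hg.continuousAt hmem, mem_of_superset hmem fun w hw => hg' w hw⟩

/-- Near a point of level one, the linearizations `Dg(w)` of an sc¹ map exist, and `Dg(w) k`
depends continuously on `(w, k) ∈ F₁ ⊕ F₀`. -/
theorem ScOneAt.exists_deriv {g : F.Lvl 0 → G.Lvl 0} {y : F.Lvl (0 + 1)}
    (h : ScOneAt F G g (F.incl 0 y)) : ∃ (g₁ : F.Lvl (0 + 1) → G.Lvl (0 + 1))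
      (Dg : F.Lvl (0 + 1) → F.Lvl 0 →L[ℝ] G.Lvl 0),
      (∀ᶠ w in 𝓝 y, HasScDeriv g w (g₁ w) (Dg w)) ∧
      ∀ k, ContinuousAt (fun p : F.Lvl (0 + 1) × F.Lvl 0 => Dg p.1 p.2) (y, k) := by
  obtain ⟨U, hU, hy, h, T', hT, h1⟩ := h
  rw [isScTangent_iff] at hT
  choose! g₁ Dg hD hTD using hT
  have hmem : F.incl 0 ⁻¹' U ∈ 𝓝 y := (hU.preimage (F.incl 0).continuous).mem_nhds hy
  refine ⟨g₁, Dg, mem_of_superset hmem hD, fun k => ?_⟩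
  have hc : ContinuousOn T' (F.tangentSet U) := h1.continuousOn
  have hmem' : F.tangentSet U ∈ 𝓝 ((y, k) : F.Lvl (0 + 1) × F.Lvl 0) :=
    (hU.preimage ((F.incl 0).continuous.comp continuous_fst)).mem_nhds hy
  have := (hc.continuousAt hmem').snd
  refine this.congr (mem_of_superset hmem' ?_)
  rintro ⟨w, v⟩ hw
  exact congrArg Prod.snd (hTD w hw v)

/-- The chain rule.  As `Dg` is only strongly continuous, the term `(Dg(w) - Dg(y)) (Df(x) h)` is
small relative to `‖h‖₁` because the inclusion `E₁ → E₀` is compact: strong convergence is uniform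
on compact sets. -/
theorem HasScDeriv.comp {f : E.Lvl 0 → F.Lvl 0} {g : F.Lvl 0 → G.Lvl 0} {x : E.Lvl (0 + 1)}
    {y : F.Lvl (0 + 1)} {z : G.Lvl (0 + 1)} {D : E.Lvl 0 →L[ℝ] F.Lvl 0}
    {D' : F.Lvl 0 →L[ℝ] G.Lvl 0} (hg : HasScDeriv g y z D') (hf : HasScDeriv f x y D)
    (hgy : ScOneAt F G g (F.incl 0 y)) (hfx : ScOneAt E F f (E.incl 0 x)) :
    HasScDeriv (g ∘ f) x z (D'.comp D) := by
  refine ⟨?_, by rw [hg.incl_eq, hf.incl_eq, Function.comp_apply]⟩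
  obtain ⟨f₁, hf₁, hff⟩ := hfx.exists_lift
  obtain ⟨g₁, Dg, hDg, hDc⟩ := hgy.exists_deriv
  have hDy : Dg y = D' := (hDg.self_of_nhds.unique hg).2
  have hyx : f₁ x = y := F.incl_injective 0 (hff.self_of_nhds.trans hf.incl_eq.symm)
  -- The operators `Dg(w)` are bounded uniformly in `w` near `y`.
  obtain ⟨M, hM, hbound⟩ : ∃ M : ℝ, 0 < M ∧ ∀ᶠ w in 𝓝 y, ∀ k, ‖Dg w k‖ ≤ M * ‖k‖ := by
    have h0 := (hDc 0).eventually (Metric.ball_mem_nhds _ one_pos)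
    rw [nhds_prod_eq] at h0
    obtain ⟨P, hP, Q, hQ, hPQ⟩ := eventually_prod_iff.1 h0
    obtain ⟨δ, hδ, hQδ⟩ := Metric.eventually_nhds_iff.1 hQ
    refine ⟨2 / δ, by positivity, hP.mono fun w hw k => ?_⟩
    rcases eq_or_ne k 0 with rfl | hk
    · simp
    have hk' : 0 < ‖k‖ := norm_pos_iff.2 hk
    have h1 : ‖Dg w ((δ / 2 / ‖k‖) • k)‖ < 1 := by
      have := hPQ hw (y := (δ / 2 / ‖k‖) • k) (hQδ ?_)
      · simpa using this
      · rw [dist_zero_right, norm_smul, Real.norm_of_nonneg (by positivity),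
          div_mul_cancel₀ _ hk'.ne']
        linarith
    rw [map_smul, norm_smul, Real.norm_of_nonneg (by positivity)] at h1
    have h2 : δ / 2 / ‖k‖ * ‖Dg w k‖ * (2 / δ * ‖k‖) = ‖Dg w k‖ := by
      field_simp
    rw [← h2]
    have : 0 < 2 / δ * ‖k‖ := by positivity
    nlinarith
  -- `K` contains the image in `E₀` of a ball of radius `ρ` in `E₁`; the bound on `K` becomes
  -- a bound by `‖h‖₁` by rescaling `h` to norm `ρ / 2`.
  obtain ⟨K, hK, hK0⟩ := E.incl_compact 0
  obtain ⟨ρ, hρ, hKρ⟩ := Metric.mem_nhds_iff.1 hK0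
  rw [Asymptotics.isLittleO_iff]
  intro c hc
  have hunif : ∀ᶠ w in 𝓝 y, ∀ k ∈ D '' K, ‖Dg w k - D' k‖ < c / 2 * (ρ / 2) := by
    refine (hK.image D.continuous).eventually_forall_of_forall_eventually fun k _ => ?_
    have h1 : ContinuousAt (fun p : F.Lvl (0 + 1) × F.Lvl 0 => Dg p.1 p.2 - D' p.2) (y, k) :=
      (hDc k).sub (D'.continuous.comp continuous_snd).continuousAt
    refine h1.norm.tendsto.eventually_lt_const ?_
    rw [hDy, sub_self, norm_zero]
    positivity
  have hcomp : ∀ᶠ w in 𝓝 y, ∀ h : E.Lvl (0 + 1),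
      ‖Dg w (D (E.incl 0 h)) - D' (D (E.incl 0 h))‖ ≤ c / 2 * ‖h‖ := by
    refine hunif.mono fun w hw h => ?_
    rcases eq_or_ne h 0 with rfl | hh
    · simp
    have hh' : 0 < ‖h‖ := norm_pos_iff.2 hh
    have hmem : E.incl 0 ((ρ / 2 / ‖h‖) • h) ∈ K := by
      refine hKρ ?_
      rw [mem_ball_zero_iff, norm_smul, Real.norm_of_nonneg (by positivity),
        div_mul_cancel₀ _ hh'.ne']
      linarith
    have h1 := hw _ ⟨_, hmem, rfl⟩
    simp only [map_smul, ← smul_sub] at h1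
    rw [norm_smul, Real.norm_of_nonneg (by positivity)] at h1
    have h2 : ‖Dg w (D (E.incl 0 h)) - D' (D (E.incl 0 h))‖ * (ρ / 2) =
        ρ / 2 / ‖h‖ * ‖Dg w (D (E.incl 0 h)) - D' (D (E.incl 0 h))‖ * ‖h‖ := by
      field_simp
    have h3 : 0 < ρ / 2 := by positivity
    refine le_of_mul_le_mul_right ?_ h3
    rw [h2]
    nlinarith
  obtain ⟨δ, hδ, hδall⟩ := Metric.eventually_nhds_iff.1 (hDg.and (hbound.and hcomp))
  have hshift : Tendsto (fun h : E.Lvl (0 + 1) => x + h) (𝓝 0) (𝓝 x) := by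
    have : Continuous fun h : E.Lvl (0 + 1) => x + h := by fun_prop
    simpa using this.tendsto 0
  have hnear : ∀ᶠ h in 𝓝 (0 : E.Lvl (0 + 1)), dist (f₁ (x + h)) y < δ := by
    have := hf₁.tendsto.comp hshift
    rw [hyx] at this
    exact this.eventually (Metric.ball_mem_nhds _ hδ)
  have hsmall := (Asymptotics.isLittleO_iff.1 hf.isLittleO) (show 0 < c / 2 / M by positivity)
  filter_upwards [hnear, hshift.eventually hff, hsmall] with h hh₁ hh₂ hh₃
  set k := f₁ (x + h) - y with hk
  set u := D (E.incl 0 h) with hu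
  have hkδ : ‖k‖ < δ := by rwa [hk, ← dist_eq_norm]
  have hfx : f (E.incl 0 x) = F.incl 0 y := hf.incl_eq.symm
  have hek : F.incl 0 k = f (E.incl 0 (x + h)) - f (E.incl 0 x) := by
    rw [hk, map_sub, hh₂, hfx]
  have he : ‖F.incl 0 k - u‖ ≤ c / 2 / M * ‖h‖ := by rw [hek]; exact hh₃
  -- The mean value inequality on the segment from `y` to `f (x + h)` in `F₁`.
  have hseg : ∀ t ∈ Set.Icc (0 : ℝ) 1, HasScDeriv g (y + t • k) (g₁ (y + t • k)) (Dg (y + t • k)) ∧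
      (∀ v, ‖Dg (y + t • k) v‖ ≤ M * ‖v‖) ∧ ∀ h : E.Lvl (0 + 1),
        ‖Dg (y + t • k) (D (E.incl 0 h)) - D' (D (E.incl 0 h))‖ ≤ c / 2 * ‖h‖ := by
    intro t ht
    refine hδall ?_
    rw [dist_eq_norm, add_sub_cancel_left, norm_smul, Real.norm_of_nonneg ht.1]
    exact (mul_le_of_le_one_left (norm_nonneg _) ht.2).trans_lt hkδ
  have hder : ∀ t ∈ Set.Icc (0 : ℝ) 1,
      HasDerivWithinAt (fun t : ℝ => g (F.incl 0 (y + t • k)) - t • D' u)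
        (Dg (y + t • k) (F.incl 0 k) - D' u) (Set.Icc 0 1) t := by
    intro t ht
    have h1 : HasDerivAt (fun t : ℝ => y + t • k) k t := by
      simpa using ((hasDerivAt_id t).smul_const k).const_add y
    have h2 := (hseg t ht).1.hasFDerivAt.comp_hasDerivAt t h1
    have h3 : HasDerivAt (fun t : ℝ => t • D' u) (D' u) t := by
      simpa using (hasDerivAt_id t).smul_const (D' u)
    exact (h2.sub h3).hasDerivWithinAt
  have hle : ∀ t ∈ Set.Ico (0 : ℝ) 1, ‖Dg (y + t • k) (F.incl 0 k) - D' u‖ ≤ c * ‖h‖ := by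
    intro t ht
    obtain ⟨-, h1, h2⟩ := hseg t (Set.Ico_subset_Icc_self ht)
    have h3 : Dg (y + t • k) (F.incl 0 k) - D' u =
        Dg (y + t • k) (F.incl 0 k - u) + (Dg (y + t • k) u - D' u) := by
      rw [(Dg (y + t • k)).map_sub (F.incl 0 k) u, sub_add_sub_cancel]
    rw [h3]
    calc _ ≤ M * ‖F.incl 0 k - u‖ + c / 2 * ‖h‖ := (norm_add_le _ _).trans (add_le_add (h1 _) (h2 h))
      _ ≤ M * (c / 2 / M * ‖h‖) + c / 2 * ‖h‖ := by gcongr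
      _ = c * ‖h‖ := by field_simp; ring
  have := norm_image_sub_le_of_norm_deriv_le_segment_01' hder hle
  have hyk : y + (1 : ℝ) • k = f₁ (x + h) := by rw [one_smul, hk]; abel
  rw [hyk, hh₂] at this
  simp only [zero_smul, one_smul, add_zero, sub_zero, hf.incl_eq] at this
  refine le_trans (le_of_eq ?_) this
  simp only [Function.comp_apply, ContinuousLinearMap.comp_apply]
  congr 1
  abel

theorem ScOneAt.comp {f : E.Lvl 0 → F.Lvl 0} {g : F.Lvl 0 → G.Lvl 0} {x : E.Lvl 0}
    (hg : ScOneAt F G g (f x)) (hf : ScOneAt E F f x) : ScOneAt E G (g ∘ f) x := by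
  obtain ⟨V, hV, hxV, hg⟩ := hg
  obtain ⟨U, hU, hxU, hf⟩ := hf
  have hW : IsOpen (U ∩ f ⁻¹' V) := hf.1.continuousOn.isOpen_inter_preimage hU hV
  have hf' := hf.mono (Set.inter_subset_left : U ∩ f ⁻¹' V ⊆ U)
  refine ⟨U ∩ f ⁻¹' V, hW, ⟨hxU, hxV⟩, hg.1.comp hf'.1 fun z hz => hz.2, ?_⟩
  obtain ⟨Tg, hTg, hg1⟩ := hg.2
  obtain ⟨Tf, hTf, hf1⟩ := hf'.2
  refine ⟨Tg ∘ Tf, ?_, hg1.comp hf1 ?_⟩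
  · rw [isScTangent_iff]
    intro w hw
    obtain ⟨y, D, hD, hT⟩ := hTf.hasScDeriv hw
    have hy : F.incl 0 y ∈ V := by rw [hD.incl_eq]; exact hw.2
    obtain ⟨z, D', hD', hT'⟩ := hTg.hasScDeriv hy
    refine ⟨z, D'.comp D, hD'.comp hD ⟨V, hV, hy, hg⟩ ⟨_, hW, hw, hf'⟩, fun v => ?_⟩
    exact (congrArg Tg (hT v)).trans (hT' (D v))
  · rintro ⟨w, v⟩ hw
    obtain ⟨y, D, hD, hT⟩ := hTf.hasScDeriv hw
    change F.incl 0 (Tf (w, v)).1 ∈ V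
    rw [hT]
    exact hD.incl_eq ▸ hw.2

end Calculus

/-! ### Tangent vectors of retracts -/

section Retract

variable {E F G : ScBanach.{e}}

/-- `Tf p = p'`, in terms of the germ of `f` at the base point of `p`. -/
def HasTangent (f : E.Lvl 0 → F.Lvl 0) (p : E.tangent.Lvl 0) (p' : F.tangent.Lvl 0) : Prop :=
  ∃ D, HasScDeriv f p.1 p'.1 D ∧ D p.2 = p'.2

theorem HasTangent.incl_eq {f : E.Lvl 0 → F.Lvl 0} {p : E.tangent.Lvl 0} {p' : F.tangent.Lvl 0}
    (h : HasTangent f p p') : F.incl 0 p'.1 = f (E.incl 0 p.1) := h.choose_spec.1.incl_eq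

theorem HasTangent.unique {f : E.Lvl 0 → F.Lvl 0} {p : E.tangent.Lvl 0} {p' p'' : F.tangent.Lvl 0}
    (h : HasTangent f p p') (h' : HasTangent f p p'') : p' = p'' := by
  obtain ⟨D, hD, hp⟩ := h
  obtain ⟨D', hD', hp'⟩ := h'
  obtain ⟨h1, rfl⟩ := hD.unique hD'
  exact Prod.ext h1 (hp.symm.trans hp')

theorem HasTangent.congr {f g : E.Lvl 0 → F.Lvl 0} {p : E.tangent.Lvl 0} {p' : F.tangent.Lvl 0}
    (h : HasTangent f p p') (hfg : f =ᶠ[𝓝 (E.incl 0 p.1)] g) : HasTangent g p p' :=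
  let ⟨D, hD, hp⟩ := h
  ⟨D, hD.congr hfg, hp⟩

theorem HasTangent.comp {f : E.Lvl 0 → F.Lvl 0} {g : F.Lvl 0 → G.Lvl 0} {p : E.tangent.Lvl 0}
    {p' : F.tangent.Lvl 0} {p'' : G.tangent.Lvl 0} (hg : HasTangent g p' p'')
    (hf : HasTangent f p p') (hg1 : ScOneAt F G g (F.incl 0 p'.1))
    (hf1 : ScOneAt E F f (E.incl 0 p.1)) : HasTangent (g ∘ f) p p'' := by
  obtain ⟨D, hD, hp⟩ := hf
  obtain ⟨D', hD', hp'⟩ := hg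
  exact ⟨D'.comp D, hD'.comp hD hg1 hf1, (congrArg D' hp).trans hp'⟩

theorem ScOneAt.hasTangent {f : E.Lvl 0 → F.Lvl 0} {p : E.tangent.Lvl 0}
    (h : ScOneAt E F f (E.incl 0 p.1)) : ∃ p', HasTangent f p p' := by
  obtain ⟨y, D, hD⟩ := h.hasScDeriv
  exact ⟨(y, D p.2), D, hD, rfl⟩

theorem IsScTangent.hasTangent {U : Set (E.Lvl 0)} {f : E.Lvl 0 → F.Lvl 0}
    {T' : E.tangent.Lvl 0 → F.tangent.Lvl 0} (h : IsScTangent E F U f T') {p : E.tangent.Lvl 0}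
    (hp : E.incl 0 p.1 ∈ U) : HasTangent f p (T' p) := by
  obtain ⟨y, D, hD, hT⟩ := h.hasScDeriv hp
  have hTp : T' p = (y, D p.2) := hT p.2
  rw [hTp]
  exact ⟨D, hD, rfl⟩

namespace IsScRetraction

variable {U : Set (E.Lvl 0)} {r : E.Lvl 0 → E.Lvl 0} {O : Set (E.Lvl 0)}

theorem scOneAt (h : IsScRetraction E U r O) {x : E.Lvl 0} (hx : x ∈ U) : ScOneAt E E r x :=
  ⟨U, h.isOpen, hx, h.smooth 1⟩

theorem continuousOn (h : IsScRetraction E U r O) : ContinuousOn r U :=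
  ScZero.continuousOn (h.smooth 0)

theorem apply_mem (h : IsScRetraction E U r O) {x : E.Lvl 0} (hx : x ∈ U) : r x ∈ O :=
  h.image ▸ ⟨x, hx, rfl⟩

theorem subset (h : IsScRetraction E U r O) : O ⊆ U := by
  rw [← h.image]
  exact h.mapsTo.image_subset

theorem apply_eq (h : IsScRetraction E U r O) {x : E.Lvl 0} (hx : x ∈ O) : r x = x := by
  rw [← h.image] at hx
  obtain ⟨y, hy, rfl⟩ := hx
  exact h.idem y hy

/-- Open subsets of sc-smooth retracts are sc-smooth retracts. -/
theorem restrict (h : IsScRetraction E U r O) {B : Set (E.Lvl 0)} (hB : B ⊆ O)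
    (hU : IsOpen (U ∩ r ⁻¹' B)) : IsScRetraction E (U ∩ r ⁻¹' B) r B where
  isOpen := hU
  mapsTo x hx := ⟨h.mapsTo hx.1, by rw [Set.mem_preimage, h.idem x hx.1]; exact hx.2⟩
  smooth := h.smooth.mono Set.inter_subset_left
  idem x hx := h.idem x hx.1
  image := by
    refine Set.Subset.antisymm (Set.image_subset_iff.2 fun x hx => hx.2) fun x hx => ?_
    have hrx := h.apply_eq (hB hx)
    exact ⟨x, ⟨h.subset (hB hx), by rwa [Set.mem_preimage, hrx]⟩, hrx⟩

/-- The tangent of the retract `O` is the fixed point set of `Tr`, for every retraction `r`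
with image `O`. -/
theorem mem_tangent_iff (h : IsScRetraction E U r O) {p : E.tangent.Lvl 0} :
    p ∈ retractTangent E O ↔ E.incl 0 p.1 ∈ O ∧ HasTangent r p p := by
  constructor
  · rintro ⟨V, s, hs, T', hT, q, hq, rfl⟩
    have hsq := hT.hasTangent hq
    have hO : E.incl 0 (T' q).1 ∈ O := by
      rw [hsq.incl_eq]
      exact hs.apply_mem hq
    obtain ⟨p', hp'⟩ := (h.scOneAt (h.subset hO)).hasTangent
    have hc := (hp'.comp hsq (h.scOneAt (h.subset hO)) (hs.scOneAt hq)).congr (g := s)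
      (eventually_of_mem (hs.isOpen.mem_nhds hq) fun x hx => h.apply_eq (hs.apply_mem hx))
    rw [hc.unique hsq] at hp'
    exact ⟨hO, hp'⟩
  · rintro ⟨hO, hp⟩
    obtain ⟨-, T', hT, -⟩ := h.smooth 1
    exact ⟨U, r, h, T', hT, p, h.subset hO, (hT.hasTangent (h.subset hO)).unique hp⟩

end IsScRetraction

end Retract

/-! ### Coordinate representatives of maps between M-polyfolds -/

namespace Chart

variable {Z Z' Z'' : Type*} [TopologicalSpace Z] [TopologicalSpace Z'] [TopologicalSpace Z'']

/-- The domain of a chosen retraction onto the image of a chart. -/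
noncomputable def dom (κ : Chart.{e} Z) : Set (κ.E.Lvl 0) := κ.isScRetract_target.choose

/-- A chosen retraction onto the image of a chart. -/
noncomputable def retr (κ : Chart.{e} Z) : κ.E.Lvl 0 → κ.E.Lvl 0 :=
  κ.isScRetract_target.choose_spec.choose

theorem isScRetraction (κ : Chart.{e} Z) : IsScRetraction κ.E κ.dom κ.retr κ.φ.target :=
  κ.isScRetract_target.choose_spec.choose_spec

/-- The map `φ⁻¹ ∘ r` from the open set `κ.dom` onto the domain of the chart. -/
noncomputable def inv (κ : Chart.{e} Z) (x : κ.E.Lvl 0) : Z := κ.φ.symm (κ.retr x)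

/-- The coordinate representative `φ' ∘ f ∘ φ⁻¹ ∘ r` of `f`.  Composing with `r` makes it a map on
an open set of an sc-Banach space. -/
noncomputable def loc (κ : Chart.{e} Z) (κ' : Chart.{e} Z') (f : Z → Z') (x : κ.E.Lvl 0) :
    κ'.E.Lvl 0 := κ'.φ (f (κ.inv x))

variable (κ : Chart.{e} Z)

theorem apply_inv {x : κ.E.Lvl 0} (hx : x ∈ κ.dom) : κ.φ (κ.inv x) = κ.retr x :=
  κ.φ.right_inv (κ.isScRetraction.apply_mem hx)

theorem apply_mem_dom {z : Z} (hz : z ∈ κ.φ.source) : κ.φ z ∈ κ.dom :=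
  κ.isScRetraction.subset (κ.φ.map_source hz)

theorem inv_apply {z : Z} (hz : z ∈ κ.φ.source) : κ.inv (κ.φ z) = z := by
  rw [inv, κ.isScRetraction.apply_eq (κ.φ.map_source hz), κ.φ.left_inv hz]

theorem inv_retr {x : κ.E.Lvl 0} (hx : x ∈ κ.dom) : κ.inv (κ.retr x) = κ.inv x := by
  rw [inv, κ.isScRetraction.idem x hx, inv]

theorem dom_mem_nhds {x : κ.E.Lvl 0} (hx : x ∈ κ.dom) : κ.dom ∈ 𝓝 x :=
  κ.isScRetraction.isOpen.mem_nhds hx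

theorem source_mem_nhds {z : Z} (hz : z ∈ κ.φ.source) : κ.φ.source ∈ 𝓝 z :=
  κ.isOpen_source.mem_nhds hz

theorem tendsto_inv {z : Z} (hz : z ∈ κ.φ.source) : Tendsto κ.inv (𝓝 (κ.φ z)) (𝓝 z) := by
  have h : ContinuousOn κ.inv κ.dom :=
    κ.continuousOn_symm.comp κ.isScRetraction.continuousOn fun _ hx => κ.isScRetraction.apply_mem hx
  have := (h.continuousAt (κ.dom_mem_nhds (κ.apply_mem_dom hz))).tendsto
  rwa [κ.inv_apply hz] at this

theorem loc_apply (κ' : Chart.{e} Z') (f : Z → Z') {z : Z} (hz : z ∈ κ.φ.source) :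
    κ.loc κ' f (κ.φ z) = κ'.φ (f z) := by rw [loc, κ.inv_apply hz]

theorem loc_congr (κ' : Chart.{e} Z') {f g : Z → Z'} {z : Z} (hz : z ∈ κ.φ.source)
    (h : f =ᶠ[𝓝 z] g) : κ.loc κ' f =ᶠ[𝓝 (κ.φ z)] κ.loc κ' g :=
  ((κ.tendsto_inv hz).eventually h).mono fun _ hx => congrArg κ'.φ hx

theorem loc_comp (κ' : Chart.{e} Z') (κ'' : Chart.{e} Z'') {f : Z → Z'} (g : Z' → Z'') {z : Z}
    (hz : z ∈ κ.φ.source) (hf : ContinuousAt f z) (hz' : f z ∈ κ'.φ.source) :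
    κ'.loc κ'' g ∘ κ.loc κ' f =ᶠ[𝓝 (κ.φ z)] κ.loc κ'' (g ∘ f) := by
  filter_upwards [(κ.tendsto_inv hz).eventually (hf (κ'.source_mem_nhds hz'))] with x hx
  simp only [loc, Function.comp_apply]
  rw [κ'.inv_apply hx]

theorem loc_id {z : Z} (hz : z ∈ κ.φ.source) : κ.loc κ id =ᶠ[𝓝 (κ.φ z)] κ.retr :=
  eventually_of_mem (κ.dom_mem_nhds (κ.apply_mem_dom hz)) fun _ hx => κ.apply_inv hx

/-- Let `B` be an open subset of the domain of the chart, and `A ⊆ B` open.  A retraction with image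
`φ(B)` restricts to one with image `φ(A)`. -/
theorem restrict {A B : Set Z} (hA : IsOpen A) (hAB : A ⊆ B) (hB : B ⊆ κ.φ.source)
    {V : Set (κ.E.Lvl 0)} {s : κ.E.Lvl 0 → κ.E.Lvl 0} (h : IsScRetraction κ.E V s (κ.φ '' B)) :
    IsScRetraction κ.E (V ∩ s ⁻¹' (κ.φ '' A)) s (κ.φ '' A) := by
  refine h.restrict (Set.image_mono hAB) ?_
  have hs : Set.MapsTo s V κ.φ.target := fun x hx => by
    obtain ⟨b, hb, hbx⟩ := h.apply_mem hx
    rw [← hbx]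
    exact κ.φ.map_source (hB hb)
  have : V ∩ s ⁻¹' (κ.φ '' A) = V ∩ (κ.φ.symm ∘ s) ⁻¹' A := by
    ext x
    refine and_congr_right fun hx => ⟨?_, fun hxA => ⟨_, hxA, κ.φ.right_inv (hs hx)⟩⟩
    rintro ⟨a, ha, hax⟩
    rw [Set.mem_preimage, Function.comp_apply, ← hax, κ.φ.left_inv (hB (hAB ha))]
    exact ha
  rw [this]
  exact (κ.continuousOn_symm.comp h.continuousOn hs).isOpen_inter_preimage h.isOpen hA

theorem isScRetraction_restrict {A : Set Z} (hA : IsOpen A) (hAκ : A ⊆ κ.φ.source) :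
    IsScRetraction κ.E (κ.dom ∩ κ.retr ⁻¹' (κ.φ '' A)) κ.retr (κ.φ '' A) :=
  κ.restrict hA hAκ subset_rfl (by rw [κ.φ.image_source_eq_target]; exact κ.isScRetraction)

/-- Sc-smoothness of a map on an open part of the domain of a chart may be tested with the chosen
retraction. -/
theorem scOneAt_loc_of_smooth {κ : Chart.{e} Z} {κ' : Chart.{e} Z'} {A : Set Z} (hA : IsOpen A)
    (hAκ : A ⊆ κ.φ.source) {f : Z → Z'}
    (h : ScSmoothOnRetract κ.E κ'.E (κ.φ '' A) (κ'.φ ∘ f ∘ κ.φ.symm)) {z : Z} (hz : z ∈ A) :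
    ScOneAt κ.E κ'.E (κ.loc κ' f) (κ.φ z) := by
  obtain ⟨V, s, hs, hsm⟩ := h
  have hr : κ.retr (κ.φ z) = κ.φ z := κ.isScRetraction.apply_eq (κ.φ.map_source (hAκ hz))
  have h1 : ScOneAt κ.E κ'.E ((κ'.φ ∘ f ∘ κ.φ.symm) ∘ s) (κ.retr (κ.φ z)) :=
    ⟨V, hs.isOpen, by rw [hr]; exact hs.subset ⟨z, hz, rfl⟩, hsm 1⟩
  refine (h1.comp (κ.isScRetraction.scOneAt (κ.apply_mem_dom (hAκ hz)))).congr ?_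
  have hA' := (κ.tendsto_inv (hAκ hz)).eventually (hA.mem_nhds hz)
  filter_upwards [hA', κ.dom_mem_nhds (κ.apply_mem_dom (hAκ hz))] with x hxA hx
  have : s (κ.retr x) = κ.retr x := hs.apply_eq ⟨_, hxA, κ.apply_inv hx⟩
  simp only [Function.comp_apply, this]
  rfl

/-- The tangent map of `f` in charts is the tangent map of a coordinate representative of `f`. -/
theorem retractTangentMap_iff {κ : Chart.{e} Z} {κ' : Chart.{e} Z'} {A : Set Z} (hA : IsOpen A)
    (hAκ : A ⊆ κ.φ.source) {f : Z → Z'}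
    (hf : ∀ z ∈ A, ScOneAt κ.E κ'.E (κ.loc κ' f) (κ.φ z)) {z : Z} (hz : z ∈ A)
    {p : κ.E.tangent.Lvl 0} {p' : κ'.E.tangent.Lvl 0} (hp : p ∈ retractTangent κ.E κ.φ.target)
    (hpz : κ.E.incl 0 p.1 = κ.φ z) :
    RetractTangentMap κ.E κ'.E (κ.φ '' A) (κ'.φ ∘ f ∘ κ.φ.symm) p p' ↔
      HasTangent (κ.loc κ' f) p p' := by
  have hpA : κ.E.incl 0 p.1 ∈ κ.φ '' A := ⟨z, hz, hpz.symm⟩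
  have hloc : ScOneAt κ.E κ'.E (κ.loc κ' f) (κ.E.incl 0 p.1) := hpz ▸ hf z hz
  constructor
  · rintro ⟨hpT, V, s, hs, T', hT, rfl⟩
    have hsp := (hs.mem_tangent_iff.1 hpT).2
    have hsV := hs.subset hpA
    have heq : κ.loc κ' f ∘ s =ᶠ[𝓝 (κ.E.incl 0 p.1)] (κ'.φ ∘ f ∘ κ.φ.symm) ∘ s := by
      refine eventually_of_mem (hs.isOpen.mem_nhds hsV) fun x hx => ?_
      obtain ⟨a, ha, hax⟩ := hs.apply_mem hx
      simp only [Function.comp_apply, ← hax]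
      rw [κ.loc_apply κ' f (hAκ ha), κ.φ.left_inv (hAκ ha)]
    obtain ⟨p', hp'⟩ := hloc.hasTangent
    have hc := (hp'.comp hsp hloc (hs.scOneAt hsV)).congr heq
    rwa [(hT.hasTangent hsV).unique hc]
  · intro h
    have hs := κ.isScRetraction_restrict hA hAκ
    obtain ⟨T', hT⟩ : ∃ T', IsScTangent κ.E κ'.E (κ.dom ∩ κ.retr ⁻¹' (κ.φ '' A))
        ((κ'.φ ∘ f ∘ κ.φ.symm) ∘ κ.retr) T' := by
      refine exists_isScTangent fun x hx => ?_
      obtain ⟨hxd, a, ha, hax⟩ := hx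
      have h1 : ScOneAt κ.E κ'.E (κ.loc κ' f) (κ.retr (κ.E.incl 0 x)) := by
        rw [← hax]
        exact hf a ha
      -- Away from the retract, the representative factors through `r`.
      refine ((h1.comp (κ.isScRetraction.scOneAt hxd)).congr ?_).hasScDeriv
      refine eventually_of_mem (κ.dom_mem_nhds hxd) fun u hu => ?_
      exact congrArg (fun w => κ'.φ (f w)) (κ.inv_retr hu)
    refine ⟨hs.mem_tangent_iff.2 ⟨hpA, (κ.isScRetraction.mem_tangent_iff.1 hp).2⟩, _, _, hs, T', hT,
      (hT.hasTangent (hs.subset hpA)).unique h⟩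

end Chart

/-! ### Germs of sc¹ maps of M-polyfolds and their tangent maps -/

namespace MPolyfold

section

variable {Z Z' Z'' : Type*} [TopologicalSpace Z] [TopologicalSpace Z'] [TopologicalSpace Z'']
variable {X : MPolyfold.{e} Z} {Y : MPolyfold.{e} Z'} {W : MPolyfold.{e} Z''}

theorem ScSmoothOn.isOpen {S : Set Z} {f : Z → Z'} (h : X.ScSmoothOn Y S f) (hS : IsOpen S)
    {κ : Chart.{e} Z} {κ' : Chart.{e} Z'} : IsOpen (κ.φ.source ∩ S ∩ f ⁻¹' κ'.φ.source) := by
  rw [Set.inter_assoc]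
  exact κ.isOpen_source.inter (h.1.isOpen_inter_preimage hS κ'.isOpen_source)

theorem ScSmoothOn.mono {S S' : Set Z} {f : Z → Z'} (h : X.ScSmoothOn Y S f) (hS' : IsOpen S')
    (hS : S' ⊆ S) : X.ScSmoothOn Y S' f := by
  refine ⟨h.1.mono hS, fun κ hκ κ' hκ' => ?_⟩
  obtain ⟨V, s, hs, hsm⟩ := h.2 κ hκ κ' hκ'
  refine ⟨_, s, κ.restrict ?_ ?_ ?_ hs, hsm.mono Set.inter_subset_left⟩
  · rw [Set.inter_assoc]
    exact κ.isOpen_source.inter ((h.1.mono hS).isOpen_inter_preimage hS' κ'.isOpen_source)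
  · gcongr
  · exact fun z hz => hz.1.1

/-- Sc-smooth maps do not lower the regularity of points. -/
theorem ScSmoothOn.mem_level {S : Set Z} {f : Z → Z'} (h : X.ScSmoothOn Y S f) {m : ℕ} {z : Z}
    (hz : z ∈ S) (hm : z ∈ X.level m) : f z ∈ Y.level m := by
  obtain ⟨κ, hκ, hzκ, hm⟩ := hm
  obtain ⟨κ', hκ', hzκ'⟩ := Y.cover (f z)
  refine ⟨κ', hκ', hzκ', ?_⟩
  obtain ⟨V, s, hs, hsm⟩ := h.2 κ hκ κ' hκ'
  have hmem : κ.φ z ∈ κ.φ '' (κ.φ.source ∩ S ∩ f ⁻¹' κ'.φ.source) := ⟨z, ⟨⟨hzκ, hz⟩, hzκ'⟩, rfl⟩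
  have := ScZero.mem_range (hsm 0) (hs.subset hmem) hm
  simpa only [Function.comp_apply, hs.apply_eq hmem, κ.φ.left_inv hzκ] using this

variable (X Y) in
/-- `f` is continuous at `z`, and all its coordinate representatives around `z` are of class sc¹
near `z`. -/
def ScOneAt (f : Z → Z') (z : Z) : Prop :=
  ContinuousAt f z ∧ ∀ κ ∈ X.atlas, z ∈ κ.φ.source → ∀ κ' ∈ Y.atlas, f z ∈ κ'.φ.source →
    Polyfold.ScOneAt κ.E κ'.E (κ.loc κ' f) (κ.φ z)

theorem ScSmoothOn.scOneAt {S : Set Z} {f : Z → Z'} (h : X.ScSmoothOn Y S f) (hS : IsOpen S)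
    {z : Z} (hz : z ∈ S) : ScOneAt X Y f z :=
  ⟨h.1.continuousAt (hS.mem_nhds hz), fun κ hκ hzκ κ' hκ' hzκ' =>
    Chart.scOneAt_loc_of_smooth (h.isOpen hS) (fun _ ha => ha.1.1) (h.2 κ hκ κ' hκ')
      ⟨⟨hzκ, hz⟩, hzκ'⟩⟩

variable (X) in
theorem scOneAt_id (z : Z) : ScOneAt X X id z :=
  ⟨continuousAt_id, fun κ hκ hzκ κ' hκ' hzκ' => Chart.scOneAt_loc_of_smooth (f := id)
    (κ.isOpen_source.inter κ'.isOpen_source) Set.inter_subset_left (X.compat κ hκ κ' hκ')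
      ⟨hzκ, hzκ'⟩⟩

theorem ScOneAt.comp {f : Z → Z'} {g : Z' → Z''} {z : Z} (hg : ScOneAt Y W g (f z))
    (hf : ScOneAt X Y f z) : ScOneAt X W (g ∘ f) z := by
  refine ⟨hg.1.comp hf.1, fun κ hκ hz κ'' hκ'' hz'' => ?_⟩
  obtain ⟨κ', hκ', hz'⟩ := Y.cover (f z)
  refine Polyfold.ScOneAt.congr ?_ (κ.loc_comp κ' κ'' g hz hf.1 hz')
  refine Polyfold.ScOneAt.comp ?_ (hf.2 κ hκ hz κ' hκ' hz')
  rw [κ.loc_apply κ' f hz]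
  exact hg.2 κ' hκ' hz' κ'' hκ'' hz''

/-- In charts, the linearization of an sc¹ map at a point maps tangent vectors to tangent
vectors. -/
theorem ScOneAt.exists_hasScDeriv {f : Z → Z'} {z : Z} (hf : ScOneAt X Y f z) {κ : Chart.{e} Z}
    (hκ : κ ∈ X.atlas) (hz : z ∈ κ.φ.source) {κ' : Chart.{e} Z'} (hκ' : κ' ∈ Y.atlas)
    (hz' : f z ∈ κ'.φ.source) {x : κ.E.Lvl (0 + 1)} (hx : κ.E.incl 0 x = κ.φ z) :
    ∃ y D, HasScDeriv (κ.loc κ' f) x y D ∧ κ'.E.incl 0 y = κ'.φ (f z) ∧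
      ∀ v, (y, D v) ∈ retractTangent κ'.E κ'.φ.target := by
  have h1 : Polyfold.ScOneAt κ.E κ'.E (κ.loc κ' f) (κ.E.incl 0 x) := hx ▸ hf.2 κ hκ hz κ' hκ' hz'
  obtain ⟨y, D, hD⟩ := h1.hasScDeriv
  have hy : κ'.E.incl 0 y = κ'.φ (f z) := by rw [hD.incl_eq, hx, κ.loc_apply κ' f hz]
  refine ⟨y, D, hD, hy, fun v => κ'.isScRetraction.mem_tangent_iff.2
    ⟨hy ▸ κ'.φ.map_source hz', ?_⟩⟩
  have h2 : Polyfold.ScOneAt κ'.E κ'.E κ'.retr (κ'.E.incl 0 y) :=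
    κ'.isScRetraction.scOneAt (hy ▸ κ'.apply_mem_dom hz')
  obtain ⟨y', D', hD'⟩ := h2.hasScDeriv
  have heq : κ'.retr ∘ κ.loc κ' f =ᶠ[𝓝 (κ.E.incl 0 x)] κ.loc κ' f := by
    rw [hx]
    filter_upwards [(κ.tendsto_inv hz).eventually (hf.1 (κ'.source_mem_nhds hz'))] with u hu
    exact κ'.isScRetraction.apply_eq (κ'.φ.map_source hu)
  obtain ⟨rfl, hDD⟩ := ((hD'.comp hD h2 h1).congr heq).unique hD
  exact ⟨D', hD', congrArg (fun A : κ.E.Lvl 0 →L[ℝ] κ'.E.Lvl 0 => A v) hDD⟩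

/-- `Tf` maps the tangent vector represented by `a` to the one represented by `b`. -/
def TangentRep.Push (f : Z → Z') {z : Z} {z' : Z'} (a : X.TangentRep z) (b : Y.TangentRep z') :
    Prop := HasTangent (a.κ.loc b.κ f) a.vec b.vec

namespace TangentRep

variable {z : Z}

theorem Push.comp {f : Z → Z'} {g : Z' → Z''} {z' : Z'} {z'' : Z''} {a : X.TangentRep z}
    {b : Y.TangentRep z'} {c : W.TangentRep z''} (hbc : Push g b c) (hab : Push f a b)
    (hg : ScOneAt Y W g z') (hf : ScOneAt X Y f z) (hz' : f z = z') (hz'' : g z' = z'') :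
    Push (g ∘ f) a c := by
  subst hz' hz''
  refine (HasTangent.comp hbc hab ?_ ?_).congr ?_
  · rw [b.vec_base]
    exact hg.2 b.κ b.mem_atlas b.mem_source c.κ c.mem_atlas c.mem_source
  · rw [a.vec_base]
    exact hf.2 a.κ a.mem_atlas a.mem_source b.κ b.mem_atlas b.mem_source
  · rw [a.vec_base]
    exact a.κ.loc_comp b.κ c.κ g a.mem_source hf.1 b.mem_source

theorem Push.congr {f g : Z → Z'} {z' : Z'} {a : X.TangentRep z} {b : Y.TangentRep z'}
    (h : Push f a b) (hfg : f =ᶠ[𝓝 z] g) : Push g a b :=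
  HasTangent.congr h (by rw [a.vec_base]; exact a.κ.loc_congr b.κ a.mem_source hfg)

theorem push_id_refl (a : X.TangentRep z) : Push id a a :=
  (a.κ.isScRetraction.mem_tangent_iff.1 a.vec_mem).2.congr
    (by rw [a.vec_base]; exact (a.κ.loc_id a.mem_source).symm)

/-- Tangent vectors can be pushed forward into every chart around the image point. -/
theorem exists_push {f : Z → Z'} {z' : Z'} (a : X.TangentRep z) (hf : ScOneAt X Y f z)
    (hz' : f z = z') {κ' : Chart.{e} Z'} (hκ' : κ' ∈ Y.atlas) (hzκ' : z' ∈ κ'.φ.source) :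
    ∃ vec h h', Push f a (⟨κ', hκ', hzκ', vec, h, h'⟩ : Y.TangentRep z') := by
  subst hz'
  obtain ⟨y, D, hD, hy, hv⟩ := hf.exists_hasScDeriv a.mem_atlas a.mem_source hκ' hzκ' a.vec_base
  exact ⟨(y, D a.vec.2), hv _, hy, D, hD, rfl⟩

theorem Push.symm {a b : X.TangentRep z} (h : Push id a b) : Push id b a := by
  obtain ⟨vec, hv, hv', h'⟩ := b.exists_push (scOneAt_id X z) rfl a.mem_atlas a.mem_source
  have h1 : Push id a _ := h'.comp h (scOneAt_id X z) (scOneAt_id X z) rfl rfl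
  have h2 : vec = a.vec := HasTangent.unique h1 a.push_id_refl
  subst h2
  exact h'

theorem rel_iff_push {a b : X.TangentRep z} : a.Rel b ↔ Push id a b :=
  Chart.retractTangentMap_iff (f := id) (a.κ.isOpen_source.inter b.κ.isOpen_source)
    Set.inter_subset_left
    (fun y hy => (scOneAt_id X y).2 a.κ a.mem_atlas hy.1 b.κ b.mem_atlas hy.2)
    ⟨a.mem_source, b.mem_source⟩ a.vec_mem a.vec_base

theorem rel_equivalence : Equivalence (Rel (X := X) (z := z)) where
  refl a := rel_iff_push.2 a.push_id_refl
  symm h := rel_iff_push.2 (rel_iff_push.1 h).symm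
  trans h h' := rel_iff_push.2 <|
    (rel_iff_push.1 h').comp (rel_iff_push.1 h) (scOneAt_id X z) (scOneAt_id X z) rfl rfl

theorem mk_eq_iff {a b : X.TangentRep z} :
    (Quot.mk _ a : X.TangentSpace z) = Quot.mk _ b ↔ Push id a b :=
  (rel_equivalence.quot_mk_eq_iff a b).trans rel_iff_push

end TangentRep

/-- `Tf (z, h) = (z', h')`, in terms of the germ of `f` at `z`. -/
def TangentGerm (f : Z → Z') {z : Z} {z' : Z'} (h : X.TangentSpace z) (h' : Y.TangentSpace z') :
    Prop := ∃ (a : X.TangentRep z) (b : Y.TangentRep z'),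
      h = Quot.mk _ a ∧ h' = Quot.mk _ b ∧ a.Push f b

section

variable {f : Z → Z'} {z : Z} {z' : Z'}

/-- The relation does not depend on the representatives. -/
theorem tangentGerm_mk_iff (hf : ScOneAt X Y f z) (hz' : f z = z') {a : X.TangentRep z}
    {b : Y.TangentRep z'} :
    TangentGerm f (Quot.mk _ a : X.TangentSpace z) (Quot.mk _ b : Y.TangentSpace z') ↔
      a.Push f b := by
  refine ⟨?_, fun h => ⟨a, b, rfl, rfl, h⟩⟩
  rintro ⟨a', b', ha, hb, h⟩
  subst hz'
  have hb' := TangentRep.mk_eq_iff.1 hb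
  have h1 : a.Push f b' := h.comp (TangentRep.mk_eq_iff.1 ha) hf (scOneAt_id X z) rfl rfl
  exact hb'.symm.comp h1 (scOneAt_id Y _) hf rfl rfl

theorem TangentGerm.congr {g : Z → Z'} {h : X.TangentSpace z} {h' : Y.TangentSpace z'}
    (hh : TangentGerm f h h') (hfg : f =ᶠ[𝓝 z] g) : TangentGerm g h h' :=
  let ⟨a, b, ha, hb, hab⟩ := hh
  ⟨a, b, ha, hb, hab.congr hfg⟩

theorem existsUnique_tangentGerm (hf : ScOneAt X Y f z) (hz' : f z = z') (h : X.TangentSpace z) :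
    ∃! h' : Y.TangentSpace z', TangentGerm f h h' := by
  obtain ⟨a, rfl⟩ := Quot.exists_rep h
  obtain ⟨κ', hκ', hzκ'⟩ := Y.cover z'
  obtain ⟨vec, hv, hv', hp⟩ := a.exists_push hf hz' hκ' hzκ'
  refine ⟨_, (tangentGerm_mk_iff hf hz').2 hp, fun k hk => ?_⟩
  obtain ⟨b, rfl⟩ := Quot.exists_rep k
  rw [tangentGerm_mk_iff hf hz'] at hk
  obtain ⟨vec', hw, hw', hp'⟩ := b.exists_push (scOneAt_id Y z') rfl hκ' hzκ'
  have h1 : a.Push f _ := hp'.comp hk (scOneAt_id Y z') hf hz' rfl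
  obtain rfl : vec = vec' := HasTangent.unique hp h1
  exact TangentRep.mk_eq_iff.2 hp'

theorem TangentGerm.comp {g : Z' → Z''} {z'' : Z''} {h : X.TangentSpace z}
    {h' : Y.TangentSpace z'} {h'' : W.TangentSpace z''} (hg' : TangentGerm g h' h'')
    (hf' : TangentGerm f h h') (hg : ScOneAt Y W g z') (hf : ScOneAt X Y f z) (hz' : f z = z')
    (hz'' : g z' = z'') : TangentGerm (g ∘ f) h h'' := by
  obtain ⟨a, b, rfl, rfl, hab⟩ := hf'
  obtain ⟨c, rfl⟩ := Quot.exists_rep h''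
  rw [tangentGerm_mk_iff hg hz''] at hg'
  exact ⟨a, c, rfl, rfl, hg'.comp hab hg hf hz' hz''⟩

theorem tangentGerm_id (h : X.TangentSpace z) : TangentGerm id h h := by
  obtain ⟨a, rfl⟩ := Quot.exists_rep h
  exact ⟨a, a, rfl, rfl, a.push_id_refl⟩

/-- The tangent map of a map on an open set does not depend on the set. -/
theorem tangentMap_iff {S : Set Z} (hS : IsOpen S) (hf : ∀ y ∈ S, ScOneAt X Y f y) (hz : z ∈ S)
    (hz' : f z = z') {h : X.TangentSpace z} {h' : Y.TangentSpace z'} :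
    X.TangentMap Y S f h h' ↔ TangentGerm f h h' := by
  have key : ∀ (a : X.TangentRep z) (b : Y.TangentRep z'),
      RetractTangentMap a.κ.E b.κ.E (a.κ.φ '' (a.κ.φ.source ∩ S ∩ f ⁻¹' b.κ.φ.source))
        (b.κ.φ ∘ f ∘ a.κ.φ.symm) a.vec b.vec ↔ a.Push f b := fun a b => by
    have hc : ContinuousOn f S := fun y hy => (hf y hy).1.continuousWithinAt
    refine Chart.retractTangentMap_iff (f := f)
      (A := a.κ.φ.source ∩ S ∩ f ⁻¹' b.κ.φ.source) ?_ (fun _ ha => ha.1.1) (fun y hy => (hf y hy.1.2).2 a.κ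
      a.mem_atlas hy.1.1 b.κ b.mem_atlas hy.2) (z := z) ⟨⟨a.mem_source, hz⟩, ?_⟩ a.vec_mem a.vec_base
    · rw [Set.inter_assoc]
      exact a.κ.isOpen_source.inter (hc.isOpen_inter_preimage hS b.κ.isOpen_source)
    · rw [Set.mem_preimage, hz']
      exact b.mem_source
  simp only [TangentMap, hz, hz', true_and, TangentGerm, key]

end

end

end MPolyfold

/-! ### The local sc-diffeomorphisms defined by morphisms -/

theorem MPolyfold.IsScDiffeo.restrOpen {Z Z' : Type*} [TopologicalSpace Z] [TopologicalSpace Z']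
    {X : MPolyfold.{e} Z} {Y : MPolyfold.{e} Z'} {σ : OpenPartialHomeomorph Z Z'}
    (h : X.IsScDiffeo Y σ) {s : Set Z} (hs : IsOpen s) : X.IsScDiffeo Y (σ.restrOpen s hs) :=
  ⟨h.1.mono (σ.restrOpen s hs).open_source Set.inter_subset_left,
    h.2.mono (σ.restrOpen s hs).open_target Set.inter_subset_left⟩

namespace PolyfoldStructure

variable {C : Type u} [Category.{v} C] [GCT C] {S : PolyfoldStructure.{e, w} C}
variable {c c' c'' : C}

/-- The point `(q, φ, q')` of `M(Ψ, Ψ')` for a morphism `φ : c → c'`, where `Ψ(q) = c` and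
`Ψ'(q') = c'`. -/
def transitionPoint {Ψ : S.F c} {Ψ' : S.F c'} {q : Ψ.1.O} {q' : Ψ'.1.O} (hq : Ψ.1.obj q = c)
    (hq' : Ψ'.1.obj q' = c') (φ : c ⟶ c') : Transition Ψ.1 Ψ'.1 :=
  ⟨q, q', eqToHom hq ≫ φ ≫ eqToHom hq'.symm⟩

/-- A neighborhood of the point `x` of `M(Ψ, Ψ')` on which the source map and the target map
restrict to sc-diffeomorphisms `σ` and `θ` onto open sets. -/
structure TransitionNhd {Ψ : S.F c} {Ψ' : S.F c'} (x : Transition Ψ.1 Ψ'.1) where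
  σ : OpenPartialHomeomorph (Transition Ψ.1 Ψ'.1) Ψ.1.O
  θ : OpenPartialHomeomorph (Transition Ψ.1 Ψ'.1) Ψ'.1.O
  mem_source : x ∈ σ.source
  source_eq : θ.source = σ.source
  src_eqOn : Set.EqOn Transition.src σ σ.source
  tgt_eqOn : Set.EqOn Transition.tgt θ θ.source
  src_diffeo : (S.M Ψ Ψ').IsScDiffeo Ψ.1.mpoly σ
  tgt_diffeo : (S.M Ψ Ψ').IsScDiffeo Ψ'.1.mpoly θ

namespace TransitionNhd

variable {Ψ : S.F c} {Ψ' : S.F c'} {x : Transition Ψ.1 Ψ'.1}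

theorem nonempty (x : Transition Ψ.1 Ψ'.1) : Nonempty (TransitionNhd x) := by
  obtain ⟨σ, hσ, hσ', hσd⟩ := S.src_local Ψ Ψ' x
  obtain ⟨θ, hθ, hθ', hθd⟩ := S.tgt_local Ψ Ψ' x
  exact ⟨σ.restrOpen θ.source θ.open_source, θ.restrOpen σ.source σ.open_source, ⟨hσ, hθ⟩,
    Set.inter_comm _ _, hσ'.mono Set.inter_subset_left, hθ'.mono Set.inter_subset_left,
    hσd.restrOpen θ.open_source, hθd.restrOpen σ.open_source⟩

/-- The map `L = t ∘ (s|U)⁻¹`. -/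
noncomputable def map (N : TransitionNhd x) : Ψ.1.O → Ψ'.1.O := N.θ ∘ N.σ.symm

variable (N : TransitionNhd x)

theorem src_mem_target : x.src ∈ N.σ.target := by
  rw [N.src_eqOn N.mem_source]
  exact N.σ.map_source N.mem_source

theorem symm_src {y : Transition Ψ.1 Ψ'.1} (hy : y ∈ N.σ.source) : N.σ.symm y.src = y := by
  rw [N.src_eqOn hy, N.σ.left_inv hy]

theorem map_src {y : Transition Ψ.1 Ψ'.1} (hy : y ∈ N.σ.source) : N.map y.src = y.tgt := by
  rw [map, Function.comp_apply, N.symm_src hy, N.tgt_eqOn (N.source_eq ▸ hy)]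

theorem symm_mem {z : Ψ.1.O} (hz : z ∈ N.σ.target) : N.σ.symm z ∈ N.σ.source :=
  N.σ.map_target hz

theorem src_symm {z : Ψ.1.O} (hz : z ∈ N.σ.target) : (N.σ.symm z).src = z := by
  rw [N.src_eqOn (N.symm_mem hz), N.σ.right_inv hz]

theorem tgt_symm {z : Ψ.1.O} (hz : z ∈ N.σ.target) : (N.σ.symm z).tgt = N.map z :=
  N.tgt_eqOn (N.source_eq ▸ N.symm_mem hz)

theorem scOneAt_map {z : Ψ.1.O} (hz : z ∈ N.σ.target) : Ψ.1.mpoly.ScOneAt Ψ'.1.mpoly N.map z :=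
  (N.tgt_diffeo.1.scOneAt N.θ.open_source (N.source_eq ▸ N.symm_mem hz)).comp
    (N.src_diffeo.2.scOneAt N.σ.open_target hz)

theorem mem_level (N : TransitionNhd x) {m : ℕ} (hm : x.src ∈ Ψ.1.mpoly.level m) : x.tgt ∈ Ψ'.1.mpoly.level m := by
  have h := N.src_diffeo.2.mem_level N.src_mem_target hm
  rw [N.symm_src N.mem_source] at h
  have := N.tgt_diffeo.1.mem_level (N.source_eq ▸ N.mem_source) h
  rwa [← N.tgt_eqOn (N.source_eq ▸ N.mem_source)] at this

/-- The germ of `L` at the source of `x` is determined by the transitions close to `x`. -/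
theorem map_eventuallyEq {f : Ψ.1.O → Ψ'.1.O}
    (h : ∀ᶠ z in 𝓝 x.src, ∃ y ∈ N.σ.source, y.src = z ∧ y.tgt = f z) : N.map =ᶠ[𝓝 x.src] f := by
  filter_upwards [h]
  rintro z ⟨y, hy, rfl, hyf⟩
  rw [N.map_src hy, hyf]

theorem tendsto_symm : Tendsto N.σ.symm (𝓝 x.src) (𝓝 x) := by
  have := (N.σ.continuousAt_symm N.src_mem_target).tendsto
  rwa [N.symm_src N.mem_source] at this

theorem target_mem_nhds : N.σ.target ∈ 𝓝 x.src := N.σ.open_target.mem_nhds N.src_mem_target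

theorem source_mem_nhds : N.σ.source ∈ 𝓝 x := N.σ.open_source.mem_nhds N.mem_source

theorem map_eventuallyEq_map (N' : TransitionNhd x) : N.map =ᶠ[𝓝 x.src] N'.map := by
  refine N.map_eventuallyEq ?_
  filter_upwards [N'.tendsto_symm.eventually N.source_mem_nhds, N'.target_mem_nhds] with z h h'
  exact ⟨_, h, N'.src_symm h', N'.tgt_symm h'⟩

/-- The unit map is a continuous section of the source map through the units. -/
theorem map_eventuallyEq_id {q : Ψ.1.O} (N : TransitionNhd (Transition.unit Ψ.1 q)) :
    N.map =ᶠ[𝓝 q] id := by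
  refine N.map_eventuallyEq (x := Transition.unit Ψ.1 q) ?_
  have hc : ContinuousAt (Transition.unit Ψ.1) q :=
    (S.unit_smooth Ψ).1.continuousAt univ_mem
  filter_upwards [hc.eventually N.source_mem_nhds] with z h
  exact ⟨_, h, rfl, rfl⟩

/-- Near its source, the map `L` of a product is the composition of the maps `L` of the factors,
because the multiplication is continuous. -/
theorem map_eventuallyEq_comp {Ψ'' : S.F c''} {y : Transition Ψ'.1 Ψ''.1} (hyx : y.src = x.tgt)
    (N' : TransitionNhd y) (N'' : TransitionNhd (Transition.mul ⟨(y, x), hyx⟩)) :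
    N''.map =ᶠ[𝓝 x.src] N'.map ∘ N.map := by
  refine N''.map_eventuallyEq (x := Transition.mul ⟨(y, x), hyx⟩) ?_
  have hmul : Continuous (Transition.mul : Transition.FiberProd Ψ.1 Ψ'.1 Ψ''.1 → _) :=
    (S.mul_smooth Ψ Ψ' Ψ'').1
  have h1 := hmul.continuousAt (x := ⟨(y, x), hyx⟩) N''.source_mem_nhds
  -- The pairs `(N'.σ⁻¹ (L z), N.σ⁻¹ z)` lie in the fibered product only for `z` near `x.src`, so the
  -- continuity of the multiplication is used through a neighborhood `A` in the full product.
  obtain ⟨A, hA, hA'⟩ := mem_nhds_induced _ _ _ |>.1 h1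
  have hN : Tendsto N.map (𝓝 x.src) (𝓝 y.src) := by
    have := (N.scOneAt_map N.src_mem_target).1.tendsto
    rwa [N.map_src N.mem_source, ← hyx] at this
  have h2 : Tendsto (fun z => (N'.σ.symm (N.map z), N.σ.symm z)) (𝓝 x.src) (𝓝 (y, x)) :=
    (N'.tendsto_symm.comp hN).prodMk_nhds N.tendsto_symm
  filter_upwards [h2.eventually hA, N.target_mem_nhds, hN.eventually N'.target_mem_nhds]
    with z hz hz1 hz2
  have hs : (N'.σ.symm (N.map z)).src = (N.σ.symm z).tgt := by
    rw [N'.src_symm hz2, N.tgt_symm hz1]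
  exact ⟨Transition.mul ⟨(N'.σ.symm (N.map z), N.σ.symm z), hs⟩, hA' hz, N.src_symm hz1,
    N'.tgt_symm hz2⟩

end TransitionNhd

theorem transitionPoint_id {Ψ : S.F c} {q : Ψ.1.O} (hq : Ψ.1.obj q = c) :
    transitionPoint hq hq (𝟙 c) = Transition.unit Ψ.1 q := by
  simp [transitionPoint, Transition.unit]

theorem transitionPoint_comp {Ψ : S.F c} {Ψ' : S.F c'} {Ψ'' : S.F c''} {q : Ψ.1.O} {q' : Ψ'.1.O}
    {q'' : Ψ''.1.O} (hq : Ψ.1.obj q = c) (hq' : Ψ'.1.obj q' = c') (hq'' : Ψ''.1.obj q'' = c'')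
    (φ : c ⟶ c') (ψ : c' ⟶ c'') : transitionPoint hq hq'' (φ ≫ ψ) =
      Transition.mul ⟨(transitionPoint hq' hq'' ψ, transitionPoint hq hq' φ), rfl⟩ := by
  simp [transitionPoint, Transition.mul]

theorem regularityGE_iff (r : ℕ) (Ψ : S.F c) (q : Ψ.1.O) (hq : Ψ.1.obj q = c) :
    S.regularityGE r c ↔ q ∈ Ψ.1.mpoly.level r := by
  refine ⟨?_, fun h => ⟨Ψ.1, Ψ.2, q, hq, h⟩⟩
  rintro ⟨Ψ₀, hΨ₀, q₀, hq₀, h⟩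
  obtain ⟨N⟩ := TransitionNhd.nonempty (transitionPoint (Ψ := ⟨Ψ₀, hΨ₀⟩) hq₀ hq (𝟙 c))
  exact N.mem_level h

/-! ### The relation between tuples defined by a morphism -/

/-- Any admissible neighborhood may be used to compute `TL (q, h)`. -/
theorem lift_iff {φ : c ⟶ c'} {a : S.Tuple c} {b : S.Tuple c'}
    (N : TransitionNhd (transitionPoint a.obj_eq b.obj_eq φ)) :
    Lift φ a b ↔ MPolyfold.TangentGerm N.map a.h b.h := by
  have key : ∀ N' : TransitionNhd (transitionPoint a.obj_eq b.obj_eq φ),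
      a.Ψ.1.mpoly.TangentMap b.Ψ.1.mpoly N'.σ.target (N'.θ ∘ N'.σ.symm) a.h b.h ↔
        MPolyfold.TangentGerm N'.map a.h b.h := fun N' =>
    MPolyfold.tangentMap_iff N'.σ.open_target (fun _ hy => N'.scOneAt_map hy) N'.src_mem_target
      (N'.map_src N'.mem_source)
  constructor
  · rintro ⟨σ, θ, h1, h2, h3, h4, h5, h6, h⟩
    let N' : TransitionNhd (transitionPoint a.obj_eq b.obj_eq φ) := ⟨σ, θ, h1, h2, h3, h4, h5, h6⟩
    exact ((key N').1 h).congr (N'.map_eventuallyEq_map N)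
  · exact fun h => ⟨N.σ, N.θ, N.mem_source, N.source_eq, N.src_eqOn, N.tgt_eqOn, N.src_diffeo,
      N.tgt_diffeo, (key N).2 h⟩

theorem existsUnique_lift (φ : c ⟶ c') (a : S.Tuple c) (Ψ' : S.F c') (q' : Ψ'.1.O)
    (hq' : Ψ'.1.obj q' = c') :
    ∃! h' : Ψ'.1.mpoly.TangentSpace q', Lift φ a ⟨Ψ', q', hq', h'⟩ := by
  obtain ⟨N⟩ := TransitionNhd.nonempty (transitionPoint a.obj_eq hq' φ)
  have := MPolyfold.existsUnique_tangentGerm (N.scOneAt_map N.src_mem_target)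
    (N.map_src N.mem_source) a.h
  refine (existsUnique_congr fun h' => ?_).2 this
  exact lift_iff (b := ⟨Ψ', q', hq', h'⟩) N

theorem lift_id (a : S.Tuple c) : Lift (𝟙 c) a a := by
  obtain ⟨N⟩ := TransitionNhd.nonempty (transitionPoint a.obj_eq a.obj_eq (𝟙 c))
  rw [lift_iff N]
  refine (MPolyfold.tangentGerm_id a.h).congr (EventuallyEq.symm ?_)
  -- The type of `N` depends on the point, so the point is generalized before it is rewritten.
  have : ∀ x (N : TransitionNhd x), x = Transition.unit a.Ψ.1 a.q → N.map =ᶠ[𝓝 a.q] id := by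
    rintro x N rfl
    exact N.map_eventuallyEq_id
  exact this _ N (transitionPoint_id a.obj_eq)

theorem Lift.comp {φ : c ⟶ c'} {ψ : c' ⟶ c''} {a : S.Tuple c} {b : S.Tuple c'} {d : S.Tuple c''}
    (h : Lift φ a b) (h' : Lift ψ b d) : Lift (φ ≫ ψ) a d := by
  obtain ⟨N⟩ := TransitionNhd.nonempty (transitionPoint a.obj_eq b.obj_eq φ)
  obtain ⟨N'⟩ := TransitionNhd.nonempty (transitionPoint b.obj_eq d.obj_eq ψ)
  obtain ⟨N''⟩ := TransitionNhd.nonempty (transitionPoint a.obj_eq d.obj_eq (φ ≫ ψ))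
  rw [lift_iff N] at h
  rw [lift_iff N'] at h'
  rw [lift_iff N'']
  refine (h'.comp h (N'.scOneAt_map N'.src_mem_target) (N.scOneAt_map N.src_mem_target)
    (N.map_src N.mem_source) (N'.map_src N'.mem_source)).congr (EventuallyEq.symm ?_)
  -- The type of `N''` depends on the point, so the point is generalized before it is rewritten.
  have : ∀ x (N'' : TransitionNhd x), x = Transition.mul ⟨(transitionPoint b.obj_eq d.obj_eq ψ,
      transitionPoint a.obj_eq b.obj_eq φ), rfl⟩ → N''.map =ᶠ[𝓝 a.q] N'.map ∘ N.map := by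
    rintro x N'' rfl
    exact N.map_eventuallyEq_comp rfl N' N''
  exact this _ N'' (transitionPoint_comp _ _ _ φ ψ)

theorem lift_id_iff {Ψ : S.F c} {q : Ψ.1.O} {hq : Ψ.1.obj q = c} {h h' : Ψ.1.mpoly.TangentSpace q} :
    Lift (𝟙 c) (⟨Ψ, q, hq, h⟩ : S.Tuple c) ⟨Ψ, q, hq, h'⟩ ↔ h = h' := by
  refine ⟨fun hh => ?_, ?_⟩
  · exact (existsUnique_lift (𝟙 c) ⟨Ψ, q, hq, h⟩ Ψ q hq).unique (lift_id _) hh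
  · rintro rfl
    exact lift_id _

/-- The inverse of `TL` is computed by the inverse morphism: the composition of the two lifts is a
lift of an identity, hence trivial by uniqueness. -/
theorem Lift.inv {φ : c ⟶ c'} {a : S.Tuple c} {b : S.Tuple c'} (h : Lift φ a b) :
    Lift (inv φ) b a := by
  obtain ⟨h', hh, -⟩ := existsUnique_lift (CategoryTheory.inv φ) b a.Ψ a.q a.obj_eq
  have h1 := h.comp hh
  rw [IsIso.hom_inv_id] at h1
  obtain rfl : a.h = h' := lift_id_iff.1 h1
  exact hh

theorem tupleRel_iff {a b : S.Tuple c} : S.TupleRel ⟨c, a⟩ ⟨c, b⟩ ↔ Lift (𝟙 c) a b :=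
  ⟨fun ⟨_, h⟩ => h, fun h => ⟨rfl, h⟩⟩

theorem tupleRel_equivalence (S : PolyfoldStructure.{e, w} C) : Equivalence S.TupleRel where
  refl a := tupleRel_iff.2 (lift_id a.2)
  symm := by
    rintro ⟨c, a⟩ ⟨c', b⟩ ⟨rfl : c = c', h⟩
    have := Lift.inv (φ := 𝟙 c) h
    rw [IsIso.inv_id] at this
    exact tupleRel_iff.2 this
  trans := by
    rintro ⟨c, a⟩ ⟨c', b⟩ ⟨c'', d⟩ ⟨rfl : c = c', h⟩ ⟨rfl : c = c'', h'⟩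
    have := Lift.comp (φ := 𝟙 c) (ψ := 𝟙 c) h h'
    rw [Category.comp_id] at this
    exact tupleRel_iff.2 this

theorem toFiber_eq_iff {a b : S.Tuple c} : a.toFiber = b.toFiber ↔ Lift (𝟙 c) a b := by
  rw [← tupleRel_iff, ← (tupleRel_equivalence S).quot_mk_eq_iff]
  exact Subtype.ext_iff

theorem exists_toFiber (x : S.Fiber c) : ∃ a : S.Tuple c, a.toFiber = x := by
  obtain ⟨x, hx⟩ := x
  obtain ⟨⟨c', a⟩, rfl⟩ := Quot.exists_rep x
  obtain rfl : c' = c := hx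
  exact ⟨a, rfl⟩

theorem exists_obj_eq (Ψ : S.F c) : ∃ q : Ψ.1.O, Ψ.1.obj q = c := Ψ.1.exists_base

/-- The image of `x` under `Tφ` does not depend on the tuples that represent `x` and its image. -/
theorem exists_fiberMap (φ : c ⟶ c') (x : S.Fiber c) :
    ∃ y : S.Fiber c', ∀ (a : S.Tuple c) (b : S.Tuple c'), a.toFiber = x →
      (y = b.toFiber ↔ Lift φ a b) := by
  obtain ⟨a₀, rfl⟩ := exists_toFiber x
  obtain ⟨Ψ', hΨ'⟩ := S.nonempty c'
  obtain ⟨q', hq'⟩ := exists_obj_eq (S := S) ⟨Ψ', hΨ'⟩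
  obtain ⟨h', hh, -⟩ := existsUnique_lift φ a₀ ⟨Ψ', hΨ'⟩ q' hq'
  refine ⟨Tuple.toFiber ⟨⟨Ψ', hΨ'⟩, q', hq', h'⟩, fun a b ha => toFiber_eq_iff.trans ⟨fun hb => ?_, fun h => ?_⟩⟩
  · simpa using ((toFiber_eq_iff.1 ha).comp hh).comp hb
  · simpa using (hh.inv.comp (toFiber_eq_iff.1 ha.symm)).comp h

/-- The map `Tφ : τ⁻¹(c) → τ⁻¹(c')`. -/
noncomputable def fiberMap (φ : c ⟶ c') (x : S.Fiber c) : S.Fiber c' :=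
  (exists_fiberMap φ x).choose

theorem fiberMap_toFiber_iff (φ : c ⟶ c') (a : S.Tuple c) (b : S.Tuple c') :
    fiberMap φ a.toFiber = b.toFiber ↔ Lift φ a b :=
  (exists_fiberMap φ a.toFiber).choose_spec a b rfl

theorem fiberMap_id : (fiberMap (𝟙 c) : S.Fiber c → S.Fiber c) = id := by
  funext x
  obtain ⟨a, rfl⟩ := exists_toFiber x
  exact (fiberMap_toFiber_iff _ _ _).2 (lift_id a)

theorem fiberMap_comp (φ : c ⟶ c') (ψ : c' ⟶ c'') :
    (fiberMap (φ ≫ ψ) : S.Fiber c → S.Fiber c'') = fiberMap ψ ∘ fiberMap φ := by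
  funext x
  obtain ⟨a, rfl⟩ := exists_toFiber x
  obtain ⟨b, hb⟩ := exists_toFiber (fiberMap φ a.toFiber)
  obtain ⟨d, hd⟩ := exists_toFiber (fiberMap ψ b.toFiber)
  rw [Function.comp_apply, ← hb, ← hd, fiberMap_toFiber_iff]
  exact ((fiberMap_toFiber_iff _ _ _).1 hb.symm).comp ((fiberMap_toFiber_iff _ _ _).1 hd.symm)

end PolyfoldStructure

/-! ### The Banach space structure of the fibers -/

namespace Chart

variable {Z : Type*} [TopologicalSpace Z] (κ : Chart.{e} Z) {x : κ.E.Lvl (0 + 1)}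

theorem exists_hasScDeriv_retr (hx : κ.E.incl 0 x ∈ κ.φ.target) : ∃ D, HasScDeriv κ.retr x x D := by
  obtain ⟨y, D, hD⟩ := (κ.isScRetraction.scOneAt (κ.isScRetraction.subset hx)).hasScDeriv
  obtain rfl : y = x :=
    κ.E.incl_injective 0 (hD.incl_eq.trans (κ.isScRetraction.apply_eq hx))
  exact ⟨D, hD⟩

/-- The tangent space of the image of a chart at the point `x` of level one: the fixed vectors of
the linearization of a retraction. -/
noncomputable def tangentSubmodule (hx : κ.E.incl 0 x ∈ κ.φ.target) :
    Submodule ℝ (κ.E.Lvl 0) :=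
  LinearMap.eqLocus ((κ.exists_hasScDeriv_retr hx).choose : κ.E.Lvl 0 →ₗ[ℝ] κ.E.Lvl 0)
    LinearMap.id

theorem isClosed_tangentSubmodule (hx : κ.E.incl 0 x ∈ κ.φ.target) :
    IsClosed (κ.tangentSubmodule hx : Set (κ.E.Lvl 0)) :=
  isClosed_eq (κ.exists_hasScDeriv_retr hx).choose.continuous continuous_id

theorem mem_tangentSubmodule_iff (hx : κ.E.incl 0 x ∈ κ.φ.target)
    (h : κ.E.Lvl 0) :
    h ∈ κ.tangentSubmodule hx ↔ (x, h) ∈ retractTangent κ.E κ.φ.target := by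
  have hD := (κ.exists_hasScDeriv_retr hx).choose_spec
  refine Iff.trans ?_ κ.isScRetraction.mem_tangent_iff.symm
  refine ⟨fun hh => ⟨hx, _, hD, hh⟩, ?_⟩
  rintro ⟨-, D', hD', hh⟩
  obtain rfl := (hD.unique hD').2
  exact hh

end Chart

namespace PolyfoldStructure

variable {C : Type u} [Category.{v} C] [GCT C] {S : PolyfoldStructure.{e, w} C}
variable {c c' : C}

variable (S) in
/-- A chart around a point `q` over `c` in the domain of a uniformizer in `F(c)`, together with the
coordinates `x` of `q`, which have level one.  It is a linear parametrization of `τ⁻¹(c)`. -/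
structure FiberChart (c : C) where
  Ψ : S.F c
  q : Ψ.1.O
  obj_eq : Ψ.1.obj q = c
  κ : Chart.{e} Ψ.1.O
  mem_atlas : κ ∈ Ψ.1.mpoly.atlas
  mem_source : q ∈ κ.φ.source
  x : κ.E.Lvl (0 + 1)
  incl_eq : κ.E.incl 0 x = κ.φ q

namespace FiberChart

theorem nonempty (hc : S.regularityGE 1 c) : Nonempty (FiberChart S c) := by
  obtain ⟨Ψ, hΨ, q, hq, κ, hκ, hqκ, x, hx⟩ := hc
  exact ⟨⟨⟨Ψ, hΨ⟩, q, hq, κ, hκ, hqκ, x, hx⟩⟩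

theorem incl_mem (d : FiberChart S c) : d.κ.E.incl 0 d.x ∈ d.κ.φ.target :=
  d.incl_eq ▸ d.κ.φ.map_source d.mem_source

/-- The tangent space at `q` in the chart. -/
noncomputable abbrev space (d : FiberChart S c) : Submodule ℝ (d.κ.E.Lvl 0) :=
  d.κ.tangentSubmodule d.incl_mem

theorem mem_space (d : FiberChart S c) (h : d.κ.E.Lvl 0) :
    h ∈ d.space ↔ (d.x, h) ∈ retractTangent d.κ.E d.κ.φ.target :=
  d.κ.mem_tangentSubmodule_iff d.incl_mem h

instance (d : FiberChart S c) : CompleteSpace d.space :=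
  (d.κ.isClosed_tangentSubmodule d.incl_mem).completeSpace_coe

/-- The representative of a tangent vector at `q` with coordinates `h`. -/
def rep (d : FiberChart S c) (h : d.space) : d.Ψ.1.mpoly.TangentRep d.q :=
  ⟨d.κ, d.mem_atlas, d.mem_source, (d.x, h.1), (d.mem_space h.1).1 h.2, d.incl_eq⟩

/-- The tuple with coordinates `h`. -/
def tuple (d : FiberChart S c) (h : d.space) : S.Tuple c :=
  ⟨d.Ψ, d.q, d.obj_eq, Quot.mk _ (d.rep h)⟩

/-- Every class over `c` has exactly one representative with the given uniformizer, point, and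
chart. -/
theorem toFiber_bijective (d : FiberChart S c) :
    Function.Bijective fun h : d.space => (d.tuple h).toFiber := by
  constructor
  · intro h h' hh
    have h1 := MPolyfold.TangentRep.mk_eq_iff.1 (lift_id_iff.1 (toFiber_eq_iff.1 hh))
    have h2 := HasTangent.unique h1 (d.rep h).push_id_refl
    exact Subtype.ext (congrArg Prod.snd h2).symm
  · intro y
    obtain ⟨a, rfl⟩ := exists_toFiber y
    obtain ⟨h', hh, -⟩ := existsUnique_lift (𝟙 c) a d.Ψ d.q d.obj_eq
    obtain ⟨b, rfl⟩ := Quot.exists_rep h'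
    obtain ⟨⟨x, v⟩, hv, hx, hp⟩ := b.exists_push (MPolyfold.scOneAt_id d.Ψ.1.mpoly d.q) rfl
      d.mem_atlas d.mem_source
    obtain rfl : x = d.x := d.κ.E.incl_injective 0 (Eq.trans hx d.incl_eq.symm)
    refine ⟨⟨v, (d.mem_space v).2 hv⟩, (toFiber_eq_iff.2 ?_).symm⟩
    have h1 := MPolyfold.TangentRep.mk_eq_iff.2 hp
    have h2 : d.tuple ⟨v, (d.mem_space v).2 hv⟩ = ⟨d.Ψ, d.q, d.obj_eq, Quot.mk _ b⟩ :=
      congrArg (fun t => (⟨d.Ψ, d.q, d.obj_eq, t⟩ : S.Tuple c)) h1.symm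
    rw [h2]
    exact hh

/-- The parametrization of the fiber `τ⁻¹(c)` by the tangent space at `q` in the chart. -/
noncomputable def equiv (d : FiberChart S c) : d.space ≃ S.Fiber c :=
  Equiv.ofBijective _ d.toFiber_bijective

theorem equiv_apply (d : FiberChart S c) (h : d.space) : d.equiv h = (d.tuple h).toFiber := rfl

/-- In charts, `Tφ` is the restriction of the linearization of `L`. -/
theorem exists_continuousLinearMap (d : FiberChart S c) (d' : FiberChart S c') (φ : c ⟶ c') :
    ∃ B : d.space →L[ℝ] d'.space, ∀ h, d'.equiv (B h) = fiberMap φ (d.equiv h) := by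
  obtain ⟨N⟩ := TransitionNhd.nonempty (transitionPoint d.obj_eq d'.obj_eq φ)
  have hN := N.scOneAt_map N.src_mem_target
  have hq' : N.map d.q = d'.q := N.map_src N.mem_source
  obtain ⟨y, D, hD, hy, hv⟩ := hN.exists_hasScDeriv d.mem_atlas d.mem_source d'.mem_atlas
    (hq'.symm ▸ d'.mem_source) d.incl_eq
  obtain rfl : y = d'.x := d'.κ.E.incl_injective 0
    (hy.trans ((congrArg d'.κ.φ hq').trans d'.incl_eq.symm))
  refine ⟨(D.comp d.space.subtypeL).codRestrict d'.space fun h => (d'.mem_space _).2 (hv h.1),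
    fun h => Eq.symm ?_⟩
  rw [equiv_apply, equiv_apply, fiberMap_toFiber_iff]
  exact (lift_iff (a := d.tuple h) (b := d'.tuple _) N).2 ⟨_, _, rfl, rfl, D, hD, rfl⟩

theorem exists_continuousLinearEquiv (d : FiberChart S c) (d' : FiberChart S c') (φ : c ⟶ c') :
    ∃ B : d.space ≃L[ℝ] d'.space, ∀ h, d'.equiv (B h) = fiberMap φ (d.equiv h) := by
  obtain ⟨B, hB⟩ := d.exists_continuousLinearMap d' φ
  obtain ⟨B', hB'⟩ := d'.exists_continuousLinearMap d (inv φ)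
  refine ⟨ContinuousLinearEquiv.equivOfInverse B B' (fun h => d.equiv.injective ?_)
    (fun h => d'.equiv.injective ?_), hB⟩
  · rw [hB', hB, ← Function.comp_apply (f := fiberMap (inv φ)), ← fiberMap_comp, IsIso.hom_inv_id,
      fiberMap_id, id]
  · rw [hB, hB', ← Function.comp_apply (f := fiberMap φ), ← fiberMap_comp, IsIso.inv_hom_id,
      fiberMap_id, id]

/-- A choice of parametrization of the fiber over each object of `C¹`. -/
noncomputable def default (c : S.C₁) : FiberChart S c.obj := (nonempty c.property).some

end FiberChart

/-- The norm of the fiber `τ⁻¹(c)` that comes from a chosen parametrization. -/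
noncomputable abbrev fiberNormedAddCommGroup (c : S.C₁) : NormedAddCommGroup (S.Fiber c.obj) :=
  (FiberChart.default c).equiv.symm.normedAddCommGroup

section

attribute [local instance] fiberNormedAddCommGroup

/-- The scalar multiplication of the fiber that comes from the same parametrization. -/
noncomputable abbrev fiberNormedSpace (c : S.C₁) : NormedSpace ℝ (S.Fiber c.obj) :=
  (FiberChart.default c).equiv.symm.normedSpace ℝ

attribute [local instance] fiberNormedSpace

/-- The chosen parametrization of the fiber is an isometry. -/
noncomputable def fiberIsometry (c : S.C₁) :
    (FiberChart.default c).space ≃ₗᵢ[ℝ] S.Fiber c.obj :=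
  LinearIsometryEquiv.symm
    { (FiberChart.default c).equiv.symm.linearEquiv ℝ with norm_map' := fun _ => rfl }

theorem completeSpace_fiber (c : S.C₁) : CompleteSpace (S.Fiber c.obj) :=
  (completeSpace_congr (e := (fiberIsometry c).toEquiv)
    (fiberIsometry c).toContinuousLinearEquiv.isUniformEmbedding).1 inferInstance

/-- Every parametrization of the fiber is a topological linear isomorphism. -/
theorem FiberChart.exists_equivL {c : S.C₁} (d : FiberChart S c.obj) :
    ∃ A : d.space ≃L[ℝ] S.Fiber c.obj, ∀ h, A h = d.equiv h := by
  obtain ⟨B, hB⟩ := d.exists_continuousLinearEquiv (FiberChart.default c) (𝟙 c.obj)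
  refine ⟨B.trans (fiberIsometry c).toContinuousLinearEquiv, fun h => ?_⟩
  exact (hB h).trans (congrFun fiberMap_id _)

/-- Every `Tφ` is a topological linear isomorphism. -/
theorem exists_fiberMapL {c c' : S.C₁} (φ : c ⟶ c') :
    ∃ A : S.Fiber c.obj ≃L[ℝ] S.Fiber c'.obj, ∀ v, A v = fiberMap φ.hom v := by
  obtain ⟨B, hB⟩ :=
    (FiberChart.default c).exists_continuousLinearEquiv (FiberChart.default c') φ.hom
  refine ⟨((fiberIsometry c).symm.toContinuousLinearEquiv.trans B).trans
    (fiberIsometry c').toContinuousLinearEquiv, fun v => ?_⟩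
  refine (hB _).trans (congrArg _ ?_)
  exact (fiberIsometry c).apply_symm_apply v

end

/-! ### The tangent category -/

/-- The morphisms `x → y` of the tangent category are the morphisms `φ : τ(x) → τ(y)` with
`Tφ(x) = y`. -/
noncomputable instance tangentCategory (S : PolyfoldStructure.{e, w} C) : Category.{v} S.TObj where
  Hom x y := {φ : x.base ⟶ y.base // fiberMap φ.hom ⟨x, rfl⟩ = (⟨y, rfl⟩ : S.Fiber y.base.obj)}
  id x := ⟨𝟙 x.base, congrFun fiberMap_id _⟩
  comp φ ψ := ⟨φ.1 ≫ ψ.1, (congrFun (fiberMap_comp φ.1.hom ψ.1.hom) _).trans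
    ((congrArg (fiberMap ψ.1.hom) φ.2).trans ψ.2)⟩
  id_comp φ := Subtype.ext (Category.id_comp φ.1)
  comp_id φ := Subtype.ext (Category.comp_id φ.1)
  assoc φ ψ χ := Subtype.ext (Category.assoc φ.1 ψ.1 χ.1)

/-- The projection functor `τ` from the tangent category to `C¹`. -/
noncomputable def tangentProjection (S : PolyfoldStructure.{e, w} C) : S.TObj ⥤ S.C₁ where
  obj := TObj.base
  map φ := φ.1

end PolyfoldStructure

end Polyfold

theorem mainTheorem2 {C : Type u} [Category.{v} C] [Polyfold.GCT C]
    (S : Polyfold.PolyfoldStructure.{e, w} C) :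
    -- the regularity of an object does not depend on the choices, so that `C¹` is well-defined
    (∀ (r : ℕ) (c : C) (Ψ : S.F c) (q : Ψ.1.O), Ψ.1.obj q = c →
      (S.regularityGE r c ↔ q ∈ Ψ.1.mpoly.level r)) ∧
    -- `TL (q, h)` exists, and does not depend on the neighborhoods that define `L`
    (∀ {c c' : C} (φ : c ⟶ c') (a : S.Tuple c) (Ψ' : S.F c') (q' : Ψ'.1.O)
      (hq' : Ψ'.1.obj q' = c'),
      ∃! h' : Ψ'.1.mpoly.TangentSpace q', Polyfold.PolyfoldStructure.Lift φ a ⟨Ψ', q', hq', h'⟩) ∧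
    -- the classes `[(c, Ψ, (q, h))]` are classes of an equivalence relation
    Equivalence S.TupleRel ∧
    -- the well-defined maps `Tφ : τ⁻¹(c) → τ⁻¹(c')`, `[(c, Ψ, (q, h))] ↦ [(c', Ψ', TL (q, h))]`
    ∃ T : ∀ {c c' : C}, (c ⟶ c') → S.Fiber c → S.Fiber c',
      (∀ {c c' : C} (φ : c ⟶ c') (a : S.Tuple c) (b : S.Tuple c'),
        T φ a.toFiber = b.toFiber ↔ Polyfold.PolyfoldStructure.Lift φ a b) ∧
      (∀ c : C, T (𝟙 c) = id) ∧
      (∀ {c c' c'' : C} (φ : c ⟶ c') (ψ : c' ⟶ c''), T (φ ≫ ψ) = T ψ ∘ T φ) ∧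
      -- the fibers are Banach spaces, through the tangent spaces in charts of the uniformizers,
      -- and the maps `Tφ` are topological linear isomorphisms
      (∃ (_ : ∀ c : S.C₁, NormedAddCommGroup (S.Fiber c.obj))
        (_ : ∀ c : S.C₁, NormedSpace ℝ (S.Fiber c.obj)),
        (∀ c : S.C₁, CompleteSpace (S.Fiber c.obj)) ∧
        (∀ (c : S.C₁) (Ψ : S.F c.obj) (q : Ψ.1.O) (hq : Ψ.1.obj q = c.obj)
          (κ : Polyfold.Chart.{e} Ψ.1.O) (hκ : κ ∈ Ψ.1.mpoly.atlas) (hqκ : q ∈ κ.φ.source)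
          (x : κ.E.Lvl (0 + 1)) (hx : κ.E.incl 0 x = κ.φ q),
          ∃ (V : Submodule ℝ (κ.E.Lvl 0))
            (hV : ∀ h, h ∈ V ↔ (x, h) ∈ Polyfold.retractTangent κ.E κ.φ.target)
            (A : V ≃L[ℝ] S.Fiber c.obj), ∀ h : V,
              A h = Polyfold.PolyfoldStructure.Tuple.toFiber
                ⟨Ψ, q, hq, Quot.mk _ ⟨κ, hκ, hqκ, (x, h.1), (hV h.1).1 h.2, hx⟩⟩) ∧
        ∀ {c c' : S.C₁} (φ : c ⟶ c'), ∃ A : S.Fiber c.obj ≃L[ℝ] S.Fiber c'.obj,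
          ∀ v, A v = T φ.hom v) ∧
      -- the category `TC`, whose morphisms `x → y` are the lifts `Tφ` of the morphisms
      -- `φ : τ(x) → τ(y)` with `Tφ(x) = y`, and the projection functor `τ : TC → C¹`
      ∃ (_ : Category.{v} S.TObj) (τ : S.TObj ⥤ S.C₁) (hτ : ∀ x, τ.obj x = x.base)
        (lift : ∀ x y : S.TObj, (x ⟶ y) ≃
          {φ : x.base ⟶ y.base // T φ.hom ⟨x, rfl⟩ = ⟨y, rfl⟩}),
        ∀ (x y : S.TObj) (Φ : x ⟶ y),
          τ.map Φ = eqToHom (hτ x) ≫ (lift x y Φ).1 ≫ eqToHom (hτ y).symm := by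
  open Polyfold Polyfold.PolyfoldStructure in
  refine ⟨fun r c Ψ q hq => regularityGE_iff r Ψ q hq, fun φ a Ψ' q' hq' =>
    existsUnique_lift φ a Ψ' q' hq', tupleRel_equivalence S, fun φ => fiberMap φ,
    fun φ a b => fiberMap_toFiber_iff φ a b, fun c => fiberMap_id, fun φ ψ => fiberMap_comp φ ψ,
    ⟨fiberNormedAddCommGroup, fiberNormedSpace, completeSpace_fiber, ?_, fun φ => exists_fiberMapL φ⟩,
    tangentCategory S, tangentProjection S, fun x => rfl,
    fun x y => Equiv.refl _, fun x y Φ => ?_⟩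
  · intro c Ψ q hq κ hκ hqκ x hx
    let d : FiberChart S c.obj := ⟨Ψ, q, hq, κ, hκ, hqκ, x, hx⟩
    obtain ⟨A, hA⟩ := d.exists_equivL
    exact ⟨d.space, d.mem_space, A, hA⟩
  · exact (Category.id_comp _).trans (Category.comp_id _) |>.symm
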